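/- \textbf{Events and causal order.} Let $(\mathcal M_{\mathcal A},g_{\mathcal A})$ and $(\mathcal M_{\mathcal B},g_{\mathcal B})$ be two time-oriented Lorentzian spacetimes. In each spacetime $\mathcal X\in\{\mathcal A,\mathcal B\}$, the future-directed timelike worldline of a test particle, parametrised by proper time, crosses each of $N$ timelike future-directed worldlines, labelled $1,\dots,N$, exactly once, at proper times $\tau^{\mathcal X}_1,\dots,\tau^{\mathcal X}_N$ and at $N$ distinct points. The $a$-th crossings in $\mathcal A$ and in $\mathcal B$ are regarded as the same event $\mathcal E_a$. Put $s^{\mathcal X}_{ab}=\operatorname{sgn}(\tau^{\mathcal X}_b-\tau^{\mathcal X}_a)$, and let $\mathcal S_{\mathcal X}=(\mathcal S_{\mathcal X}^{(1)},\dots,\mathcal S_{\mathcal X}^{(N)})$ be the events ordered by increasing proper time. The causal indefiniteness $$\delta(\mathcal A,\mathcal B)=\sum_{1\le i<j\le N}\left|s^{\mathcal A}_{ij}-s^{\mathcal B}_{ij}\right|^0\qquad(0^0:=0)$$ is the number of pairs of events with opposite order in the two spacetimes. For a set $T$ of events, the causal order in $T$ is definite if $\sum_{i<j,\; i,j\in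 T}s^{\mathcal A}_{ij}s^{\mathcal B}_{ij}=\binom{|T|}{2}$, and maximally indefinite if this sum is $-\binom{|T|}{2}$. \textbf{The knot.} Draw a solid horizontal line from left to right, starting at the first and ending at the last event of $\mathcal S_{\mathcal B}$, and passing through vertices labelled $\mathcal S_{\mathcal A}^{(1)},\dots,\mathcal S_{\mathcal A}^{(N)}$ in this order. From its right end draw, below the line, a dashed path that visits the vertices labelled $\mathcal S_{\mathcal B}^{(N)},\mathcal S_{\mathcal B}^{(N-1)},\dots,\mathcal S_{\mathcal B}^{(1)}$ in this order and then ends at the left end of the line. At each vertex other than $\mathcal S_{\mathcal B}^{(1)}$ the dashed path winds around the solid line: it passes under the line to its upper side and returns over the line to its lower side, which creates two crossings. At $\mathcal S_{\mathcal B}^{(1)}$ it does not wind: it goes up and returns on the lower side of the diagram, under the line both times. Where the dashed path crosses earlier parts of itself, it stays on the side on which it last passed the solid line: over the earlier parts after winding, and under all of them after visiting $\mathcal S_{\mathcal B}^{(1)}$. The resulting closed curve is the knot $K_{\mathcal A\mathcal B}$ associated with the two causal orders. Let $\nabla(z)$ be its Alexander--Conway polynomial, which is computed recursively from $\nabla(\mathrm{O})=1$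 for the unknot and the skein relation $\nabla(L_+)=\nabla(L_-)+z\,\nabla(L_0)$, and let $\nabla(z)_2$ be its coefficient of $z^2$. \textbf{Theorem.} Suppose that the pair of causal sequences is a concatenation of subsequences, each in definite or in maximally indefinite causal order: the events are partitioned into blocks $T_1,\dots,T_n$ such that, for $k<l$, every event of $T_k$ precedes every event of $T_l$ in both spacetimes, and the causal order in each $T_k$ is definite or maximally indefinite. Then $$\nabla(z)_2=\delta(\mathcal A,\mathcal B).$$ -/

import Mathlib

open scoped Manifold ContDiff

namespace CausalKnot

section Spacetime

/-- A time-oriented spacetime: a smooth metric of Lorentzian signature `(-, +, ..., +)` on the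
smooth manifold `M`, with a continuous timelike vector field that singles out the future. -/
structure Spacetime (d : ℕ) (M : Type*) [TopologicalSpace M]
    [ChartedSpace (EuclideanSpace ℝ (Fin d)) M] [IsManifold (𝓡 d) ∞ M] where
  metric (x : M) : TangentSpace (𝓡 d) x →L[ℝ] TangentSpace (𝓡 d) x →L[ℝ] ℝ
  metric_symm (x : M) (v w : TangentSpace (𝓡 d) x) : metric x v w = metric x w v
  metric_smooth : ContMDiff (𝓡 d)
    ((𝓡 d).prod 𝓘(ℝ, EuclideanSpace ℝ (Fin d) →L[ℝ] EuclideanSpace ℝ (Fin d) →L[ℝ] ℝ)) ∞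
    (fun x ↦ Bundle.TotalSpace.mk'
      (EuclideanSpace ℝ (Fin d) →L[ℝ] EuclideanSpace ℝ (Fin d) →L[ℝ] ℝ)
      (E := fun x : M ↦ TangentSpace (𝓡 d) x →L[ℝ] TangentSpace (𝓡 d) x →L[ℝ] ℝ)
      x (metric x))
  future (x : M) : TangentSpace (𝓡 d) x
  future_continuous : Continuous (fun x ↦ (⟨x, future x⟩ : TangentBundle (𝓡 d) M))
  future_timelike (x : M) : metric x (future x) (future x) < 0
  /-- The metric is positive definite on the orthogonal complement of a timelike vector. -/
  lorentzian (x : M) (v : TangentSpace (𝓡 d) x) :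
    metric x (future x) v = 0 → v ≠ 0 → 0 < metric x v v

variable {d : ℕ} {M : Type*} [TopologicalSpace M]
  [ChartedSpace (EuclideanSpace ℝ (Fin d)) M] [IsManifold (𝓡 d) ∞ M]

/-- The velocity of a curve in a manifold. -/
noncomputable def velocity (γ : ℝ → M) (t : ℝ) : TangentSpace (𝓡 d) (γ t) :=
  mfderiv 𝓘(ℝ, ℝ) (𝓡 d) γ t (1 : ℝ)

/-- A worldline: a smooth timelike future-directed curve, defined on an open interval. -/
structure Worldline (S : Spacetime d M) where
  domain : Set ℝ
  domain_open : IsOpen domain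
  domain_interval : domain.OrdConnected
  curve : ℝ → M
  smooth : ContMDiffOn 𝓘(ℝ, ℝ) (𝓡 d) ∞ curve domain
  timelike : ∀ t ∈ domain,
    S.metric (curve t) (velocity (d := d) curve t) (velocity (d := d) curve t) < 0
  future_directed : ∀ t ∈ domain,
    S.metric (curve t) (S.future (curve t)) (velocity (d := d) curve t) < 0

/-- `N` distinct events of a spacetime: a test particle, whose worldline is parametrised by its
proper time (in units with `c = 1`), crosses each of `N` further worldlines exactly once. -/
structure Events (S : Spacetime d M) (N : ℕ) where
  particle : Worldline S
  proper : ∀ t ∈ particle.domain, S.metric (particle.curve t)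
    (velocity (d := d) particle.curve t) (velocity (d := d) particle.curve t) = -1
  worldline : Fin N → Worldline S
  /-- The proper time of the test particle at the crossing with the `a`-th worldline. -/
  properTime : Fin N → ℝ
  properTime_mem : ∀ a, properTime a ∈ particle.domain
  crosses : ∀ a, particle.curve (properTime a) ∈ (worldline a).curve '' (worldline a).domain
  crosses_once : ∀ a, ∀ t ∈ particle.domain,
    particle.curve t ∈ (worldline a).curve '' (worldline a).domain → t = properTime a
  distinct : Function.Injective (fun a ↦ particle.curve (properTime a))

end Spacetime

section CausalOrder

variable {N : ℕ}

/-- The causal order `s_{ab} = sgn (τ_b - τ_a)` of two events with proper times `τ`. -/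
noncomputable def causalOrder (τ : Fin N → ℝ) (a b : Fin N) : ℤ :=
  (SignType.sign (τ b - τ a) : ℤ)

/-- The pairwise causal order of two events across two spacetimes. -/
noncomputable def pairwiseOrder (τA τB : Fin N → ℝ) (a b : Fin N) : ℤ :=
  causalOrder τA a b * causalOrder τB a b

/-- The longitudinal causal order of a set of events across two spacetimes. -/
noncomputable def longitudinalOrder (τA τB : Fin N → ℝ) (T : Finset (Fin N)) : ℤ :=
  ∑ i ∈ T, ∑ j ∈ T with i < j, pairwiseOrder τA τB i j

/-- The causal order among the events of `T` is definite. -/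
def IsDefinite (τA τB : Fin N → ℝ) (T : Finset (Fin N)) : Prop :=
  longitudinalOrder τA τB T = (T.card.choose 2 : ℤ)

/-- The causal order among the events of `T` is maximally indefinite. -/
def IsMaximallyIndefinite (τA τB : Fin N → ℝ) (T : Finset (Fin N)) : Prop :=
  longitudinalOrder τA τB T = -(T.card.choose 2 : ℤ)

/-- The causal indefiniteness `δ = ∑_{i < j} |s_{ij}^A - s_{ij}^B| ^ 0`, with `0 ^ 0 = 0`. -/
noncomputable def causalIndefiniteness (τA τB : Fin N → ℝ) : ℕ :=
  ∑ i : Fin N, ∑ j : Fin N with i < j,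
    if |causalOrder τA i j - causalOrder τB i j| = 0 then 0 else 1

/-- The pair of causal sequences is a concatenation of subsequences, each of which satisfies `P`:
the events are partitioned into blocks, which follow each other in the same order in both
spacetimes. -/
def IsConcatenation (τA τB : Fin N → ℝ) (P : Finset (Fin N) → Prop) : Prop :=
  ∃ block : Fin N → ℕ,
    (∀ a b, block a < block b → τA a < τA b ∧ τB a < τB b) ∧
    ∀ k, P {a | block a = k}

end CausalOrder

section Knots

/-- An axis-parallel edge in the plane, from `start` to `finish`, placed at height `height`. -/
structure Edge where
  start : ℤ × ℤ
  finish : ℤ × ℤ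
  height : ℤ

/-- The passage of a curve through a lattice point, in direction `dir`, at height `height`. -/
structure Passage where
  point : ℤ × ℤ
  dir : ℤ × ℤ
  height : ℤ
deriving DecidableEq

/-- The passages of an edge through its lattice points, in order, the last one excluded. -/
def Edge.passages (e : Edge) : List Passage :=
  let dx := (e.finish.1 - e.start.1).sign
  let dy := (e.finish.2 - e.start.2).sign
  (List.range ((e.finish.1 - e.start.1).natAbs + (e.finish.2 - e.start.2).natAbs)).map
    fun n ↦ ⟨(e.start.1 + n * dx, e.start.2 + n * dy), (dx, dy), e.height⟩

/-- An oriented polygonal knot in `ℝ³`, given as the closed cyclic list of its horizontal edges;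
consecutive edges are joined by a vertical segment when their heights differ. Projecting to the
plane gives a knot diagram, whose crossings are the lattice points that are passed twice. -/
abbrev PolygonalKnot := List Edge

/-- One passage through a crossing of a link diagram: the name of the crossing, whether it is
passed on the over-strand, and the sign of the crossing. -/
structure Letter where
  crossing : ℤ × ℤ
  isOver : Bool
  sign : ℤ

/-- The signed Gauss code of an oriented link diagram: one cyclic word for each component, listing
the crossings in the order in which the component passes them. -/
abbrev GaussCode := List (List Letter)

/-- The sign of a crossing, from the directions `o` and `u` of the over- and of the under-strand. -/
def crossingSign (o u : ℤ × ℤ) : ℤ :=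
  (o.1 * u.2 - o.2 * u.1).sign

/-- The Gauss code of the diagram obtained by projecting a polygonal knot to the plane. -/
def PolygonalKnot.gaussCode (K : PolygonalKnot) : GaussCode :=
  let ps := K.flatMap Edge.passages
  [ps.flatMap fun p ↦
    (ps.filter fun q ↦ q.point = p.point ∧ q ≠ p).map fun q ↦
      if q.height < p.height then ⟨p.point, true, crossingSign p.dir q.dir⟩
      else ⟨p.point, false, crossingSign q.dir p.dir⟩]

/-- Switching the crossing `c`. -/
def GaussCode.switch (c : ℤ × ℤ) (K : GaussCode) : GaussCode :=
  K.map fun w ↦ w.map fun l ↦ if l.crossing = c then ⟨c, !l.isOver, -l.sign⟩ else l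

/-- The part of a word before its first passage through `c`. -/
def before (c : ℤ × ℤ) (w : List Letter) : List Letter :=
  w.takeWhile fun l ↦ l.crossing ≠ c

/-- The part of a word after its first passage through `c`. -/
def after (c : ℤ × ℤ) (w : List Letter) : List Letter :=
  (w.dropWhile fun l ↦ l.crossing ≠ c).tail

/-- The word `w` passes through the crossing `c`. -/
def meets (c : ℤ × ℤ) (w : List Letter) : Bool :=
  w.any fun l ↦ l.crossing = c

/-- The oriented smoothing at the crossing `c`. A component `u c v c w` splits into `u w` and `v`;
two components `u c v` and `x c y` merge into `u y x v`. -/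
def GaussCode.smooth (c : ℤ × ℤ) : GaussCode → GaussCode
  | [] => []
  | w :: K =>
    if meets c w then
      let u := before c w
      let v := after c w
      if meets c v then (u ++ after c v) :: before c v :: K
      else
        (u ++ ((K.filter (meets c)).flatMap fun x ↦ after c x ++ before c x) ++ v) ::
          K.filter fun x ↦ !meets c x
    else w :: GaussCode.smooth c K

open Polynomial in
/-- Resolve by the skein relation every crossing whose first passage is an under-passage, so that
the diagram becomes descending. The list `w` holds the letters still to be inspected, `seen` the
crossings already met, and `f` gives the polynomials of the smoothed diagrams. A descending diagram
is one of an unlink: its polynomial is `1` for one component and `0` for several. -/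
noncomputable def resolve (f : GaussCode → ℤ[X]) :
    List Letter → List (ℤ × ℤ) → GaussCode → ℤ[X]
  | [], _, K => if K.length = 1 then 1 else 0
  | l :: w, seen, K =>
    if l.isOver ∨ l.crossing ∈ seen then resolve f w (l.crossing :: seen) K
    else resolve f w (l.crossing :: seen) (K.switch l.crossing) +
      C l.sign * X * f (K.smooth l.crossing)

open Polynomial in
/-- The skein recursion for diagrams with at most `n` crossings. -/
noncomputable def conwayAux : ℕ → GaussCode → ℤ[X]
  | 0, K => resolve (fun _ ↦ 0) K.flatten [] K
  | n + 1, K => resolve (conwayAux n) K.flatten [] K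

open Polynomial in
/-- The Alexander-Conway polynomial `∇(z)` of a link diagram, computed recursively from the skein
relations `∇(O) = 1` and `∇(L₊) = ∇(L₋) + z ∇(L₀)`. (The number of letters of the Gauss code is
an upper bound for the number of crossings.) -/
noncomputable def conway (K : GaussCode) : ℤ[X] := conwayAux K.flatten.length K

end Knots

section Construction

/-- The dashed path, below the line `y = x`, between the points `(s, s)` and `(t, t)`. -/
def chord (s t height : ℤ) : List Edge :=
  [⟨(s, s), (max s t, min s t), height⟩, ⟨(max s t, min s t), (t, t), height⟩]

/-- The solid part of the diagram: a staircase along the line `y = x` from `(0, 0)` (the first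
event of `B`) past the events of `A` in their causal order to `(3 N + 3, 3 N + 3)` (the last event
of `B`), at height `0`. The event at position `i` of `A`, `i = 1, ..., N`, is at `(3 i, 3 i)`. -/
def solidPart (N : ℕ) : List Edge :=
  (List.range (N + 1)).flatMap fun i : ℕ ↦
    [⟨(3 * i, 3 * i), (3 * i, 3 * i + 3), 0⟩, ⟨(3 * i, 3 * i + 3), (3 * i + 3, 3 * i + 3), 0⟩]

/-- The dashed part of the diagram, starting at `(s, s)`, through the events at the given positions
of `A`, to `(0, 0)`.

At each event the path passes under the solid line. If it is not the last event of the list, the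
path winds around the solid line, coming back over it; at the last event it does not wind but comes
back on the side on which it was, under the solid line. On its way to the next event the path then
stays on the side on which it left the solid line: over all the dashed strands drawn so far after
winding, and under all of them after the last event. -/
def dashedPart (height s : ℤ) : List ℕ → List Edge
  | [] => chord s 0 (-1)
  | i :: ps =>
    chord s (3 * i - 1) height ++
      [⟨(3 * i - 1, 3 * i - 1), (3 * i - 1, 3 * i + 1), -1⟩,
       ⟨(3 * i - 1, 3 * i + 1), (3 * i + 1, 3 * i + 1), if ps = [] then -1 else 1⟩] ++
      dashedPart (height + 1) (3 * i + 1) ps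

/-- The knot whose dashed part visits the given positions of `A`. -/
def knotOfPositions (ps : List ℕ) : PolygonalKnot :=
  solidPart ps.length ++ dashedPart 1 (3 * ps.length + 3) ps

variable {N : ℕ}

/-- The ordered collection of events: `orderedEvents τ i` is the `i`-th event, counted from `0`,
in the order of increasing proper time. -/
noncomputable def orderedEvents (τ : Fin N → ℝ) : Equiv.Perm (Fin N) := Tuple.sort τ

/-- The position, counted from `1`, of an event in the ordered collection of events. -/
noncomputable def position (τ : Fin N → ℝ) (a : Fin N) : ℕ := ((orderedEvents τ).symm a : ℕ) + 1

/-- The knot associated to the causal orders of `A` and `B`: the dashed part runs through the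
events backwards in the causal order of `B`. -/
noncomputable def causalKnot (τA τB : Fin N → ℝ) : PolygonalKnot :=
  knotOfPositions ((List.ofFn (orderedEvents τB)).reverse.map (position τA))

end Construction

end CausalKnot

namespace CausalKnot

/-! ### The coefficient of z² of a knot diagram as a signed count of linked pairs of crossings. -/

section Conway

open Polynomial

/-! Making a knot diagram descending from its base point gives a Gauss diagram formula: the
coefficient of z² is the sum of the products of signs over the pairs of crossings passed in the
order c (under), d (over), c (over), d (under). Each crossing c first met from below contributes its
sign times the z-coefficient of its smoothing, a linking number that is read off the under-passages
of one component. This is `coeff_two_conway`; `linkedPairs_flatMap_letters` translates it from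
letters to passages of a lattice diagram.

The diagram at hand is read from the left end of the solid line. It consists of the solid line, the
dashed path up to its last vertex n, and a last strand, which is under everything. The last strand
cannot be the over-strand at c. It does not provide d either: together with the lower side, which
nothing else crosses, it runs around a square, and the part of the path between the two passages of
c is a closed loop in the plane, which enters and leaves the square equally often
(`underSum_finalPassages`). In the rest of the diagram, every later passage is above the earlier
one, except where the dashed path goes up under the solid line. So d is such an upward crossing at
some vertex k, and its over-passage on the solid line lies between the passages of c. This forces c
to begin on the solid line, as the downward crossing at some vertex j, with j before k both on the
solid line and along the dashed path (`crossingSign_mul_underSum`). Both signs are +1.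

The linked pairs thus correspond to the pairs of positions j < k in A with k visited after j. Since
the dashed path runs through B backwards, these are the pairs of events with opposite order
(`sum_countAfter`, `causalIndefiniteness_eq_sum`). -/

/-- The number of passages of a word through a crossing. -/
def occurrences (c : ℤ × ℤ) (w : List Letter) : ℕ :=
  w.countP fun l ↦ l.crossing = c

/-- The letter `l` after switching the crossings in `S`. -/
def switchIn (S : List (ℤ × ℤ)) (l : Letter) : Letter :=
  if l.crossing ∈ S then ⟨l.crossing, !l.isOver, -l.sign⟩ else l

/-- The signed number of under-passages in `x` at crossings through which `v` passes. -/
def linking (v x : List Letter) : ℤ :=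
  (x.map fun m ↦ if !m.isOver && meets m.crossing v then m.sign else 0).sum

/-- The signed number of pairs of crossings of a word that are passed in the order
`c` (under), `d` (over), `c` (over), `d` (under). -/
def linkedPairs : List Letter → ℤ
  | [] => 0
  | l :: w =>
    (if !l.isOver && meets l.crossing w then
      l.sign * linking (before l.crossing w) (after l.crossing w) else 0) + linkedPairs w

@[simp] theorem switchIn_crossing (S : List (ℤ × ℤ)) (l : Letter) :
    (switchIn S l).crossing = l.crossing := by
  unfold switchIn; split <;> rfl

@[simp] theorem switchIn_nil (l : Letter) : switchIn [] l = l := by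
  simp [switchIn]

theorem switchIn_of_notMem {S : List (ℤ × ℤ)} {l : Letter} (h : l.crossing ∉ S) :
    switchIn S l = l := by
  simp [switchIn, h]

theorem switchIn_cons {c : ℤ × ℤ} {S : List (ℤ × ℤ)} (hc : c ∉ S) (l : Letter) :
    switchIn (c :: S) l =
      if (switchIn S l).crossing = c then ⟨c, !(switchIn S l).isOver, -(switchIn S l).sign⟩
      else switchIn S l := by
  by_cases h : l.crossing = c
  · subst h
    simp [switchIn, hc]
  · have hm : l.crossing ∈ c :: S ↔ l.crossing ∈ S := by simp [h]
    rw [switchIn_crossing, if_neg h]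
    simp only [switchIn, hm]

/-- During the recursion the current diagram is always the original one with a list `S` of crossings
switched. The condition on `c` is needed because `switchIn` flips a crossing once, however often it
is listed. -/
theorem switch_map_switchIn {c : ℤ × ℤ} {S : List (ℤ × ℤ)} (hc : c ∉ S) (K : GaussCode) :
    GaussCode.switch c (K.map (List.map (switchIn S))) = K.map (List.map (switchIn (c :: S))) := by
  simp only [GaussCode.switch, List.map_map]
  refine List.map_congr_left fun w _ ↦ ?_
  simp only [Function.comp_apply, List.map_map]
  refine List.map_congr_left fun l _ ↦ ?_
  rw [Function.comp_apply, switchIn_cons hc]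

theorem before_map {f : Letter → Letter} (hf : ∀ l, (f l).crossing = l.crossing) (c : ℤ × ℤ)
    (w : List Letter) : before c (w.map f) = (before c w).map f := by
  simp only [before, List.takeWhile_map]
  congr 2
  funext l
  simp [hf]

theorem after_map {f : Letter → Letter} (hf : ∀ l, (f l).crossing = l.crossing) (c : ℤ × ℤ)
    (w : List Letter) : after c (w.map f) = (after c w).map f := by
  simp only [after, List.dropWhile_map, List.map_tail]
  congr 3
  funext l
  simp [hf]

theorem meets_map {f : Letter → Letter} (hf : ∀ l, (f l).crossing = l.crossing) (c : ℤ × ℤ)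
    (w : List Letter) : meets c (w.map f) = meets c w := by
  simp only [meets, List.any_map]
  congr 1
  funext l
  simp [hf]

/-- Smoothing looks only at the names of the crossings, so earlier switches can be pulled through
it. -/
theorem smooth_map {f : Letter → Letter} (hf : ∀ l, (f l).crossing = l.crossing) (c : ℤ × ℤ)
    (K : GaussCode) :
    GaussCode.smooth c (K.map (List.map f)) = (GaussCode.smooth c K).map (List.map f) := by
  induction K with
  | nil => rfl
  | cons w K ih =>
    have hm : (meets c ∘ List.map f) = meets c := funext (meets_map hf c)
    have hm' : ((fun x ↦ !meets c x) ∘ List.map f) = fun x ↦ !meets c x :=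
      funext fun x ↦ by simp [meets_map hf]
    simp only [List.map_cons, GaussCode.smooth, meets_map hf, before_map hf, after_map hf]
    split_ifs
    · simp
    · simp [List.filter_map, hm, hm', List.flatMap_map, List.map_flatMap, before_map hf,
        after_map hf]
    · simp [ih]

theorem meets_iff {c : ℤ × ℤ} {w : List Letter} :
    meets c w = true ↔ ∃ l ∈ w, l.crossing = c := by
  simp [meets]

theorem meets_append (c : ℤ × ℤ) (v w : List Letter) :
    meets c (v ++ w) = (meets c v || meets c w) := by
  simp [meets]

theorem meets_singleton (c : ℤ × ℤ) (l : Letter) : meets c [l] = decide (l.crossing = c) := by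
  simp [meets]

theorem meets_cons_of_meets {c : ℤ × ℤ} {w : List Letter} (l : Letter) (h : meets c w = true) :
    meets c (l :: w) = true := by
  rw [← List.singleton_append, meets_append, h, Bool.or_true]

theorem occurrences_pos_iff {c : ℤ × ℤ} {w : List Letter} :
    0 < occurrences c w ↔ meets c w = true := by
  simp [occurrences, meets]

theorem occurrences_map {f : Letter → Letter} (hf : ∀ l, (f l).crossing = l.crossing) (c : ℤ × ℤ)
    (w : List Letter) : occurrences c (w.map f) = occurrences c w := by
  simp only [occurrences, List.countP_map]
  congr 1
  funext l
  simp [hf]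

theorem occurrences_append (c : ℤ × ℤ) (v w : List Letter) :
    occurrences c (v ++ w) = occurrences c v + occurrences c w := by
  simp [occurrences]

theorem occurrences_cons (c : ℤ × ℤ) (l : Letter) (w : List Letter) :
    occurrences c (l :: w) = occurrences c w + if l.crossing = c then 1 else 0 := by
  simp [occurrences, List.countP_cons]

theorem before_append_cons {c : ℤ × ℤ} {v w : List Letter} {l : Letter} (hl : l.crossing = c)
    (hv : meets c v = false) : before c (v ++ l :: w) = v := by
  have h : ∀ m ∈ v, m.crossing ≠ c := by simpa [meets] using hv
  rw [before, List.takeWhile_append_of_pos (by simpa using h)]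
  simp [hl]

theorem after_append_cons {c : ℤ × ℤ} {v w : List Letter} {l : Letter} (hl : l.crossing = c)
    (hv : meets c v = false) : after c (v ++ l :: w) = w := by
  have h : ∀ m ∈ v, m.crossing ≠ c := by simpa [meets] using hv
  rw [after, List.dropWhile_append_of_pos (by simpa using h)]
  simp [hl]

theorem exists_split_of_meets {c : ℤ × ℤ} {w : List Letter} (h : meets c w = true) :
    ∃ v l x, w = v ++ l :: x ∧ l.crossing = c ∧ meets c v = false := by
  induction w with
  | nil => simp [meets] at h
  | cons m w ih =>
    by_cases hm : m.crossing = c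
    · exact ⟨[], m, w, rfl, hm, rfl⟩
    · obtain ⟨v, l, x, rfl, hl, hv⟩ := ih (by simpa [meets, hm] using h)
      exact ⟨m :: v, l, x, rfl, hl, by simpa [meets, hm] using hv⟩

/-- The smoothed terms carry a factor `X`, and switching preserves the number of components. Hence
the constant term does not depend on `f`, and for `conwayAux` not on the depth of the recursion. -/
theorem coeff_zero_resolve (f : GaussCode → ℤ[X]) (w : List Letter) (seen : List (ℤ × ℤ))
    (K : GaussCode) : (resolve f w seen K).coeff 0 = if K.length = 1 then 1 else 0 := by
  induction w generalizing seen K with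
  | nil => rw [resolve]; split_ifs <;> simp
  | cons l w ih =>
    rw [resolve]
    split_ifs with h1 h2 h2 <;> simp [ih, GaussCode.switch, h2, mul_assoc]

theorem coeff_zero_conwayAux (n : ℕ) (K : GaussCode) :
    (conwayAux n K).coeff 0 = if K.length = 1 then 1 else 0 := by
  cases n <;> rw [conwayAux, coeff_zero_resolve]

theorem coeff_succ_skein (p q : ℤ[X]) (a : ℤ) (n : ℕ) :
    (p + C a * X * q).coeff (n + 1) = p.coeff (n + 1) + a * q.coeff n := by
  simp [mul_assoc, coeff_X_mul]

/-- Only a crossing between the two components merges them; smoothing a self-crossing splits a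
component further. By `coeff_zero_resolve`, this decides which smoothings contribute to the
coefficient of z. -/
theorem length_smooth_pair (c : ℤ × ℤ) (a b : List Letter) :
    (GaussCode.smooth c [a, b]).length = 1 ↔
      meets c a = true ∧ meets c (after c a) = false ∧ meets c b = true := by
  by_cases ha : meets c a <;> by_cases ha' : meets c (after c a) <;> by_cases hb : meets c b <;>
    by_cases hb' : meets c (after c b) <;>
    simp [GaussCode.smooth, ha, ha', hb, hb']

theorem linking_cons (v x : List Letter) (l : Letter) :
    linking v (l :: x) =
      (if !l.isOver && meets l.crossing v then l.sign else 0) + linking v x := by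
  rw [linking, List.map_cons, List.sum_cons, linking]

theorem coeff_one_skein_pair (n : ℕ) (l : Letter) (p : ℤ[X]) (a b : List Letter)
    (S : List (ℤ × ℤ)) :
    (p + C l.sign * X * conwayAux n (GaussCode.smooth l.crossing
      ([a, b].map (List.map (switchIn S))))).coeff 1 = p.coeff 1 +
        if meets l.crossing a = true ∧ meets l.crossing (after l.crossing a) = false ∧
          meets l.crossing b = true then l.sign else 0 := by
  rw [coeff_succ_skein, smooth_map (switchIn_crossing S), coeff_zero_conwayAux, List.length_map]
  simp only [length_smooth_pair]
  simp

/-- This disposes of the letters of the second component: once the first one has been read, every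
crossing between the two has been seen, and a self-crossing contributes nothing. -/
theorem coeff_one_resolve_of_seen (n : ℕ) (a b rest : List Letter) (seen S : List (ℤ × ℤ))
    (hS : S ⊆ seen) (h : ∀ l ∈ rest, meets l.crossing a = true → l.crossing ∈ seen) :
    (resolve (conwayAux n) rest seen ([a, b].map (List.map (switchIn S)))).coeff 1 = 0 := by
  induction rest generalizing seen S with
  | nil => simp [resolve]
  | cons l rest ih =>
    have h' : ∀ m ∈ rest, meets m.crossing a = true → m.crossing ∈ l.crossing :: seen :=
      fun m hm hma ↦ List.mem_cons_of_mem _ (h m (List.mem_cons_of_mem _ hm) hma)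
    rw [resolve]
    split_ifs with h1
    · exact ih _ S (List.subset_cons_of_subset _ hS) h'
    · push Not at h1
      rw [coeff_one_skein_pair, switch_map_switchIn (fun hc ↦ h1.2 (hS hc)),
        ih _ _ (List.cons_subset_cons _ hS) h', if_neg, add_zero]
      exact fun h2 ↦ h1.2 (h l (by simp) h2.1)

/-- Induction on the unread part of the first component. An under-passage at a crossing with `b` is
met there for the first time, so it is resolved and adds its sign; all other resolved crossings have
smoothings with constant term 0. -/
theorem coeff_one_resolve_pair (n : ℕ) (done rest b : List Letter)
    (h : ∀ c, occurrences c (done ++ rest ++ b) ≤ 2) (seen S : List (ℤ × ℤ))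
    (hseen : ∀ c, c ∈ seen ↔ meets c done = true) (hS : S ⊆ seen) :
    (resolve (conwayAux n) (rest ++ b) seen
      ([done ++ rest, b].map (List.map (switchIn S)))).coeff 1 = linking b rest := by
  induction rest generalizing done seen S with
  | nil =>
    rw [List.nil_append, coeff_one_resolve_of_seen n _ b b seen S hS]
    · rfl
    · intro l _ hl
      rwa [List.append_nil, ← hseen] at hl
  | cons l rest ih =>
    have hseen' : ∀ c, c ∈ l.crossing :: seen ↔ meets c (done ++ [l]) = true := by
      intro c
      rw [List.mem_cons, hseen, meets_append, meets_singleton, Bool.or_eq_true, decide_eq_true_eq,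
        or_comm, @eq_comm _ c]
    have hcons : done ++ l :: rest = done ++ [l] ++ rest := by simp
    have hl := h l.crossing
    simp only [occurrences_append, occurrences_cons, if_true] at hl
    rw [List.cons_append, resolve, linking_cons]
    -- There are at most two passages in all, and `l` is one of them; a passage in `b` leaves none
    -- for the rest of the first component.
    have hb : meets l.crossing b = true →
        meets l.crossing done = false ∧ meets l.crossing rest = false := by
      intro hb
      rw [← occurrences_pos_iff] at hb
      constructor <;> rw [Bool.eq_false_iff, ne_eq, ← occurrences_pos_iff] <;> omega
    split_ifs with h1 h2 h2
    · simp only [Bool.and_eq_true, Bool.not_eq_true'] at h2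
      rcases h1 with h1 | h1
      · simp [h1] at h2
      · rw [hseen, (hb h2.2).1] at h1
        simp at h1
    · rw [hcons, ih _ (by simpa using h) _ S hseen' (List.subset_cons_of_subset _ hS), zero_add]
    all_goals
      push Not at h1
      rw [coeff_one_skein_pair, switch_map_switchIn (fun hc ↦ h1.2 (hS hc)), hcons,
        ih _ (by simpa using h) _ _ hseen' (List.cons_subset_cons _ hS), add_comm, ← hcons]
      simp only [Bool.and_eq_true, Bool.not_eq_true', h1.1, not_and] at h2
      have hd : meets l.crossing done = false := by
        rw [Bool.eq_false_iff, ne_eq, ← hseen]; exact h1.2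
      rw [after_append_cons rfl hd]
    · rw [if_pos ⟨by simp [meets], (hb h2.2).2, h2.2⟩]
    · rw [if_neg]
      rintro ⟨-, -, h3⟩
      simp [h3] at h2

theorem coeff_one_conwayAux_pair (n : ℕ) (a b : List Letter)
    (h : ∀ c, occurrences c (a ++ b) ≤ 2) :
    (conwayAux (n + 1) [a, b]).coeff 1 = linking b a := by
  have := coeff_one_resolve_pair n [] a b (by simpa using h) [] [] (by simp [meets]) (by simp)
  simpa [conwayAux, funext switchIn_nil] using this

theorem smooth_singleton {c : ℤ × ℤ} {u v : List Letter} {l : Letter} (hl : l.crossing = c)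
    (hu : meets c u = false) (hv : meets c v = true) :
    GaussCode.smooth c [u ++ l :: v] = [u ++ after c v, before c v] := by
  have : meets c (u ++ l :: v) = true := by simp [meets, hl]
  simp [GaussCode.smooth, this, before_append_cons hl hu, after_append_cons hl hu, hv]

/-- The invariant `hdone` says that the part already read is descending: after the switches, a
crossing that will be met again has been passed from above. Hence, when a crossing is smoothed, the
letters of `done` contribute no under-passages to the linking number, which then involves only
letters still to come. -/
theorem coeff_two_resolve (n : ℕ) (done rest : List Letter)
    (h : ∀ c, meets c (done ++ rest) = true → occurrences c (done ++ rest) = 2)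
    (seen S : List (ℤ × ℤ)) (hseen : ∀ c, c ∈ seen ↔ meets c done = true) (hS : S ⊆ seen)
    (hdone : ∀ l ∈ done, meets l.crossing rest = true → (switchIn S l).isOver = true) :
    (resolve (conwayAux (n + 1)) rest seen [(done ++ rest).map (switchIn S)]).coeff 2 =
      linkedPairs rest := by
  induction rest generalizing done seen S with
  | nil => simp [resolve, linkedPairs, coeff_one]
  | cons l rest ih =>
    have hseen' : ∀ c, c ∈ l.crossing :: seen ↔ meets c (done ++ [l]) = true := by
      intro c
      rw [List.mem_cons, hseen, meets_append, meets_singleton, Bool.or_eq_true, decide_eq_true_eq,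
        or_comm, @eq_comm _ c]
    have hcons : done ++ l :: rest = done ++ [l] ++ rest := by simp
    have hl := h l.crossing (by simp [meets])
    simp only [occurrences_append, occurrences_cons, if_true] at hl
    rw [resolve, linkedPairs]
    have hmeets : meets l.crossing rest = true ↔ l.crossing ∉ seen := by
      rw [hseen, ← occurrences_pos_iff, ← occurrences_pos_iff]
      omega
    split_ifs with h1 h2 h2
    · simp only [Bool.and_eq_true, Bool.not_eq_true', hmeets] at h2
      simp [h2] at h1
    · rw [hcons, ih _ (by simpa using h) _ S hseen' (List.subset_cons_of_subset _ hS), zero_add]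
      intro m hm hmr
      rw [List.mem_append, List.mem_singleton] at hm
      rcases hm with hm | rfl
      · exact hdone m hm (meets_cons_of_meets l hmr)
      · have := hmeets.1 hmr
        rw [switchIn_of_notMem fun hc ↦ this (hS hc)]
        exact h1.resolve_right this
    · push Not at h1
      have hlS : l.crossing ∉ S := fun hc ↦ h1.2 (hS hc)
      have hsw := switch_map_switchIn hlS [done ++ l :: rest]
      simp only [List.map_cons, List.map_nil] at hsw
      have hlr : meets l.crossing rest = true := hmeets.2 h1.2
      have hld : meets l.crossing done = false := by
        rw [Bool.eq_false_iff, ne_eq, ← hseen]; exact h1.2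
      have hsm := smooth_map (switchIn_crossing S) l.crossing [done ++ l :: rest]
      rw [smooth_singleton rfl hld hlr] at hsm
      simp only [List.map_cons, List.map_nil] at hsm
      -- The smoothing cuts off the loop `v` between the two passages and leaves `done ++ x` as the
      -- other component.
      obtain ⟨v, m, x, rfl, hm, hv⟩ := exists_split_of_meets hlr
      rw [after_append_cons hm hv, before_append_cons hm hv] at hsm ⊢
      rw [coeff_succ_skein, hsw, hsm, coeff_one_conwayAux_pair, hcons,
        ih _ (by simpa using h) _ _ hseen' (List.cons_subset_cons _ hS), add_comm]
      · congr 2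
        rw [linking, List.map_append, List.map_append, List.sum_append, linking,
          List.sum_eq_zero, zero_add, List.map_map]
        · congr 1
          refine List.map_congr_left fun y hy ↦ ?_
          rw [Function.comp_apply, switchIn_crossing, meets_map (switchIn_crossing S)]
          by_cases hyv : meets y.crossing v = true
          -- A switched crossing has a passage in `done`; with one in `v` and one in `x` it would
          -- have three.
          · rw [switchIn_of_notMem]
            intro hyS
            have h3 := h y.crossing (by
              rw [meets_append, (hseen _).1 (hS hyS), Bool.true_or])
            have h4 := occurrences_pos_iff.2 ((hseen _).1 (hS hyS))
            have h5 := occurrences_pos_iff.2 hyv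
            have h6 := occurrences_pos_iff.2 (meets_iff.2 ⟨y, hy, rfl⟩)
            simp only [occurrences_append, occurrences_cons] at h3
            omega
          · simp [hyv]
        · rw [List.map_map]
          intro z hz
          obtain ⟨y, hy, rfl⟩ := List.mem_map.1 hz
          rw [Function.comp_apply, switchIn_crossing, meets_map (switchIn_crossing S)]
          by_cases hyv : meets y.crossing v = true
          · rw [hdone y hy (meets_cons_of_meets l (by rw [meets_append, hyv, Bool.true_or]))]
            rfl
          · simp [hyv]
      · intro y hy hyr
        rw [switchIn_cons hlS, switchIn_crossing]
        rw [List.mem_append, List.mem_singleton] at hy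
        rcases hy with hy | rfl
        · rw [if_neg, hdone y hy (meets_cons_of_meets l hyr)]
          intro hyl
          rw [meets_iff.2 ⟨y, hy, hyl⟩] at hld
          simp at hld
        · rw [if_pos rfl, switchIn_of_notMem hlS]
          simp [h1.1]
      · intro c
        rw [← List.map_append, occurrences_map (switchIn_crossing S)]
        by_cases hc : meets c (done ++ l :: (v ++ m :: x)) = true
        · have h3 := h c hc
          simp only [occurrences_append, occurrences_cons] at h3 ⊢
          omega
        · have h3 : occurrences c (done ++ l :: (v ++ m :: x)) = 0 := by
            rw [← Nat.le_zero, ← not_lt, occurrences_pos_iff]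
            exact hc
          simp only [occurrences_append, occurrences_cons] at h3 ⊢
          omega
    · push Not at h1
      simp [h1.1, hmeets.2 h1.2] at h2

theorem coeff_two_conway {w : List Letter}
    (h : ∀ c, meets c w = true → occurrences c w = 2) :
    (conway [w]).coeff 2 = linkedPairs w := by
  -- A single letter would be a crossing passed only once. From two letters on, the recursion is
  -- deep enough for the two nested smoothings that the coefficient of z² involves.
  rcases hw : w with _ | ⟨l, _ | ⟨m, x⟩⟩
  · simp [conway, conwayAux, resolve, linkedPairs, coeff_one]
  · have := h l.crossing (by simp [hw, meets])
    simp [hw, occurrences] at this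
  · have := coeff_two_resolve x.length [] w h [] [] (by simp [meets]) (by simp) (by simp)
    rw [← hw]
    have hlen : [w].flatten.length = x.length + 2 := by simp [hw]
    rw [conway, hlen, conwayAux]
    simpa [funext switchIn_nil] using this

end Conway

end CausalKnot

namespace CausalKnot

/-! ### From letters of the Gauss code to passages through lattice points. -/

section Passages

/-- Two passages through the same point are at different heights, one of them horizontal and the
other vertical. -/
def Transversal (p q : Passage) : Prop :=
  p.point = q.point → p.height ≠ q.height ∧ (p.dir.1 = 0 ↔ q.dir.1 ≠ 0)

/-- The letters of the Gauss code that come from the passage `p`. -/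
def letters (ps : List Passage) (p : Passage) : List Letter :=
  (ps.filter fun q ↦ q.point = p.point ∧ q ≠ p).map fun q ↦
    if q.height < p.height then ⟨p.point, true, crossingSign p.dir q.dir⟩
    else ⟨p.point, false, crossingSign q.dir p.dir⟩

/-- The signed number of passages in `x` under passages in `v`. -/
def underSum (v x : List Passage) : ℤ :=
  (x.map fun r ↦ (v.map fun s ↦
    if s.point = r.point ∧ r.height < s.height then crossingSign s.dir r.dir else 0).sum).sum

theorem Transversal.symm {p q : Passage} (h : Transversal p q) : Transversal q p := by
  intro e
  obtain ⟨h1, h2⟩ := h e.symm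
  exact ⟨h1.symm, by tauto⟩

variable {ps : List Passage}

theorem Transversal.of_mem (hps : ps.Pairwise Transversal) {p q : Passage} (hp : p ∈ ps)
    (hq : q ∈ ps) (hpq : p ≠ q) : Transversal p q :=
  have : Std.Symm Transversal := ⟨fun _ _ h ↦ h.symm⟩
  hps.forall hp hq hpq

theorem nodup_of_pairwise_transversal (hps : ps.Pairwise Transversal) : ps.Nodup :=
  hps.imp fun h e ↦ (h (congrArg _ e)).1 (congrArg _ e)

/-- Of three passages through a point, two would be both horizontal or both vertical, so transversal
passages have no triple points. -/
theorem eq_of_point_eq (hps : ps.Pairwise Transversal) {p q r : Passage} (hp : p ∈ ps)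
    (hq : q ∈ ps) (hr : r ∈ ps) (hqp : q ≠ p) (hrp : r ≠ p) (eq : q.point = p.point)
    (er : r.point = p.point) : r = q := by
  by_contra h
  have h1 := (Transversal.of_mem hps hq hp hqp eq).2
  have h2 := (Transversal.of_mem hps hr hp hrp er).2
  have h3 := (Transversal.of_mem hps hr hq h (er.trans eq.symm)).2
  tauto

theorem filter_eq_singleton (hps : ps.Pairwise Transversal) {p q : Passage} (hp : p ∈ ps)
    (hq : q ∈ ps) (hqp : q ≠ p) (eq : q.point = p.point) :
    (ps.filter fun r ↦ r.point = p.point ∧ r ≠ p) = [q] := by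
  have hn := (nodup_of_pairwise_transversal hps).filter fun r ↦ r.point = p.point ∧ r ≠ p
  rw [← List.perm_singleton, List.perm_ext_iff_of_nodup hn (List.nodup_singleton q)]
  intro r
  simp only [List.mem_filter, decide_eq_true_eq, List.mem_singleton]
  constructor
  · rintro ⟨hr, er, hrp⟩
    exact eq_of_point_eq hps hp hq hr hqp hrp eq er
  · rintro rfl
    exact ⟨hq, eq, hqp⟩

theorem letters_eq_singleton (hps : ps.Pairwise Transversal) {p q : Passage} (hp : p ∈ ps)
    (hq : q ∈ ps) (hqp : q ≠ p) (eq : q.point = p.point) :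
    letters ps p = [if q.height < p.height then ⟨p.point, true, crossingSign p.dir q.dir⟩
      else ⟨p.point, false, crossingSign q.dir p.dir⟩] := by
  rw [letters, filter_eq_singleton hps hp hq hqp eq, List.map_singleton]

theorem crossing_of_mem_letters {p : Passage} {l : Letter} (h : l ∈ letters ps p) :
    l.crossing = p.point := by
  obtain ⟨q, _, rfl⟩ := List.mem_map.1 h
  split_ifs <;> rfl

theorem exists_of_mem_letters {p : Passage} {l : Letter} (h : l ∈ letters ps p) :
    ∃ q ∈ ps, q.point = p.point ∧ q ≠ p := by
  obtain ⟨q, hq, -⟩ := List.mem_map.1 h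
  simp only [List.mem_filter, decide_eq_true_eq] at hq
  exact ⟨q, hq.1, hq.2⟩

theorem letters_eq_nil {p : Passage} (h : ∀ q ∈ ps, q.point = p.point → q = p) :
    letters ps p = [] := by
  rw [List.eq_nil_iff_forall_not_mem]
  intro l hl
  obtain ⟨q, hq, h1, h2⟩ := exists_of_mem_letters hl
  exact h2 (h q hq h1)

theorem meets_flatMap_letters {c : ℤ × ℤ} {v : List Passage} :
    meets c (v.flatMap (letters ps)) = true ↔
      ∃ p ∈ v, p.point = c ∧ ∃ q ∈ ps, q.point = c ∧ q ≠ p := by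
  rw [meets_iff]
  constructor
  · rintro ⟨l, hl, rfl⟩
    obtain ⟨p, hp, hlp⟩ := List.mem_flatMap.1 hl
    rw [crossing_of_mem_letters hlp]
    exact ⟨p, hp, rfl, exists_of_mem_letters hlp⟩
  · rintro ⟨p, hp, rfl, q, hq, h1, h2⟩
    have : q ∈ ps.filter fun q ↦ q.point = p.point ∧ q ≠ p := by simp [hq, h1, h2]
    have := List.mem_map_of_mem (f := fun q : Passage ↦
      if q.height < p.height then (⟨p.point, true, crossingSign p.dir q.dir⟩ : Letter)
      else ⟨p.point, false, crossingSign q.dir p.dir⟩) this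
    exact ⟨_, List.mem_flatMap.2 ⟨p, hp, this⟩, crossing_of_mem_letters this⟩

theorem occurrences_flatMap_letters (hps : ps.Pairwise Transversal) {c : ℤ × ℤ}
    (h : meets c (ps.flatMap (letters ps)) = true) :
    occurrences c (ps.flatMap (letters ps)) = 2 := by
  obtain ⟨p, hp, rfl, q, hq, hqp, hne⟩ := meets_flatMap_letters.1 h
  have hterm : ∀ r ∈ ps, occurrences p.point (letters ps r) =
      if r = p then 1 else if r = q then 1 else 0 := by
    intro r hr
    split_ifs with h1 h2
    · rw [h1, letters_eq_singleton hps hp hq hne hqp]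
      split_ifs <;> simp [occurrences]
    · rw [h2, letters_eq_singleton hps hq hp hne.symm hqp.symm]
      split_ifs <;> simp [occurrences, hqp]
    · rw [occurrences, List.countP_eq_zero]
      intro l hl
      rw [crossing_of_mem_letters hl, decide_eq_true_eq]
      exact fun e ↦ h2 (eq_of_point_eq hps hp hq hr hne h1 hqp e)
  have hn := nodup_of_pairwise_transversal hps
  rw [occurrences, List.countP_flatMap]
  rw [List.map_congr_left (f := (List.countP (fun l : Letter ↦ l.crossing = p.point) ∘ letters ps))
    hterm]
  rw [← List.sum_toFinset _ hn, Finset.sum_ite, Finset.sum_ite]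
  have e1 : ps.toFinset.filter (fun r ↦ r = p) = {p} := by ext; simp; rintro rfl; exact hp
  have e2 : (ps.toFinset.filter (fun r ↦ ¬ r = p)).filter (fun r ↦ r = q) = {q} := by
    ext; simp; rintro rfl; exact ⟨hq, hne⟩
  rw [e1, e2]
  simp

/-- A passage `r` in `x` has at most one partner through the same point. Since `v` and `x` are
disjoint, the inner sum over `v` is the sign of the crossing if the partner lies in `v` above `r`,
and 0 otherwise. -/
theorem linking_flatMap_letters (hps : ps.Pairwise Transversal) {v x : List Passage}
    (hvx : (v ++ x).Sublist ps) :
    linking (v.flatMap (letters ps)) (x.flatMap (letters ps)) = underSum v x := by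
  have hn := (nodup_of_pairwise_transversal hps).sublist hvx
  have hvn := hn.of_append_left
  have hdisj := List.disjoint_of_nodup_append hn
  have hv : v ⊆ ps := fun _ h ↦ hvx.subset (List.mem_append_left x h)
  have hx : x ⊆ ps := fun _ h ↦ hvx.subset (List.mem_append_right v h)
  rw [linking, underSum, List.map_flatMap, List.flatMap_def, List.sum_flatten, List.map_map]
  congr 1
  refine List.map_congr_left fun r hr ↦ ?_
  rw [Function.comp_apply]
  by_cases h : ∃ q ∈ ps, q.point = r.point ∧ q ≠ r
  · obtain ⟨s, hs, esr, hsr⟩ := h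
    have htr := (Transversal.of_mem hps hs (hx hr) hsr esr).1
    rw [letters_eq_singleton hps (hx hr) hs hsr esr, List.map_singleton, List.sum_singleton]
    have hmeets : meets r.point (v.flatMap (letters ps)) = true ↔ s ∈ v := by
      rw [meets_flatMap_letters]
      constructor
      · rintro ⟨p, hp, e, -⟩
        have hpr : p ≠ r := by rintro rfl; exact hdisj hp hr
        rwa [← eq_of_point_eq hps (hx hr) hs (hv hp) hsr hpr esr e]
      · exact fun hsv ↦ ⟨s, hsv, esr, r, hx hr, rfl, hsr.symm⟩
    rw [List.sum_map_eq_nsmul_single s]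
    · by_cases hlt : s.height < r.height
      · simp [hlt, hlt.not_gt]
      · have hgt : r.height < s.height := by omega
        by_cases hsv : s ∈ v
        · simp [hlt, hgt, hmeets.2 hsv, esr, List.count_eq_one_of_mem hvn hsv]
        · simp [hlt, mt hmeets.1 hsv, List.count_eq_zero_of_not_mem hsv]
    · intro t hts htv
      rw [if_neg]
      rintro ⟨etr, -⟩
      have htr' : t ≠ r := by rintro rfl; exact hdisj htv hr
      exact hts (eq_of_point_eq hps (hx hr) hs (hv htv) hsr htr' esr etr)
  · push Not at h
    rw [letters_eq_nil h, List.map_nil, List.sum_nil, eq_comm]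
    apply List.sum_eq_zero
    intro z hz
    obtain ⟨s, hs, rfl⟩ := List.mem_map.1 hz
    rw [if_neg]
    rintro ⟨e, -⟩
    exact hdisj hs (h s (hv hs) e ▸ hr)

/-- A passage opens linked pairs only if the same point is passed again later and higher. `hcross`
evaluates its contribution in that case, with `v` the loop between the two passages and `x` the
rest; `hzero` covers all other passages. -/
theorem linkedPairs_flatMap_letters (hps : ps.Pairwise Transversal) (f : Passage → ℤ)
    (hcross : ∀ u p v q x, ps = u ++ p :: (v ++ q :: x) → p.point = q.point →
      p.height < q.height → crossingSign q.dir p.dir * underSum v x = f p)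
    (hzero : ∀ u p x, ps = u ++ p :: x →
      (∀ q ∈ x, p.point = q.point → q.height ≤ p.height) → f p = 0) :
    linkedPairs (ps.flatMap (letters ps)) = (ps.map f).sum := by
  suffices ∀ u x, ps = u ++ x → linkedPairs (x.flatMap (letters ps)) = (x.map f).sum from
    this [] ps rfl
  intro u x
  induction x generalizing u with
  | nil => intro _; rfl
  | cons p x ih =>
    intro e
    have hn := nodup_of_pairwise_transversal hps
    have hp : p ∈ ps := by simp [e]
    have hx : ∀ q ∈ x, q ∈ ps := fun q hq ↦ by simp [e, hq]
    have hpx : p ∉ x := by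
      rw [e] at hn
      exact (List.nodup_cons.1 hn.of_append_right).1
    have ih' := ih (u ++ [p]) (by simp [e])
    rw [List.flatMap_cons, List.map_cons, List.sum_cons, ← ih']
    by_cases h : ∃ q ∈ x, p.point = q.point
    · obtain ⟨q, hq, epq⟩ := h
      have hqp : q ≠ p := by rintro rfl; exact hpx hq
      have htr := (Transversal.of_mem hps (hx q hq) hp hqp epq.symm).1
      rw [letters_eq_singleton hps hp (hx q hq) hqp epq.symm, List.singleton_append, linkedPairs]
      congr 1
      by_cases hlt : q.height < p.height
      · rw [hzero u p x e]
        · simp [hlt]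
        · intro r hr epr
          rw [eq_of_point_eq hps hp (hx q hq) (hx r hr) hqp (by rintro rfl; exact hpx hr)
            epq.symm epr.symm]
          exact hlt.le
      · obtain ⟨v, y, rfl⟩ := List.append_of_mem hq
        have hm : meets p.point ((v ++ q :: y).flatMap (letters ps)) = true :=
          meets_flatMap_letters.2 ⟨q, hq, epq.symm, p, hp, rfl, hqp.symm⟩
        rw [← hcross u p v q y e epq (by omega), if_neg hlt, if_pos (by simpa using hm)]
        have hqvy : (v ++ q :: y).Nodup := by
          rw [e] at hn
          exact (List.nodup_cons.1 hn.of_append_right).2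
        have hmv : meets p.point (v.flatMap (letters ps)) = false := by
          rw [Bool.eq_false_iff, ne_eq, meets_flatMap_letters]
          rintro ⟨r, hr, er, -⟩
          have hrv : r ∈ v ++ q :: y := List.mem_append_left _ hr
          have := eq_of_point_eq hps hp (hx q hq) (hx r hrv) hqp (by rintro rfl; exact hpx hrv)
            epq.symm er
          subst this
          exact List.disjoint_of_nodup_append hqvy hr (by simp)
        rw [List.flatMap_append, List.flatMap_cons,
          letters_eq_singleton hps (hx q hq) hp hqp.symm epq, List.singleton_append,
          before_append_cons _ hmv, after_append_cons _ hmv,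
          linking_flatMap_letters hps]
        · rw [e]
          refine List.Sublist.trans ?_ (List.sublist_append_right _ _)
          exact ((List.Sublist.refl v).append (List.sublist_cons_self q y)).trans
            (List.sublist_cons_self _ _)
        · split_ifs <;> exact epq.symm
        · split_ifs <;> exact epq.symm
    · push Not at h
      rw [hzero u p x e fun q hq epq ↦ absurd epq (h q hq), zero_add]
      -- Either `p` is the second passage of a crossing, or its point is not a crossing at all.
      by_cases hu : ∃ q ∈ ps, q.point = p.point ∧ q ≠ p
      · obtain ⟨q, hq, eqp, hqp⟩ := hu
        have hm : meets p.point (x.flatMap (letters ps)) = false := by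
          rw [Bool.eq_false_iff, ne_eq, meets_flatMap_letters]
          rintro ⟨r, hr, er, -⟩
          exact h r hr er.symm
        rw [letters_eq_singleton hps hp hq hqp eqp, List.singleton_append, linkedPairs, if_neg,
          zero_add]
        split_ifs <;> simp [hm]
      · push Not at hu
        rw [letters_eq_nil hu, List.nil_append]

theorem coeff_two_conway_gaussCode (K : PolygonalKnot)
    (hK : (K.flatMap Edge.passages).Pairwise Transversal) :
    (conway K.gaussCode).coeff 2 = linkedPairs ((K.flatMap Edge.passages).flatMap
      (letters (K.flatMap Edge.passages))) :=
  coeff_two_conway fun _ hc ↦ occurrences_flatMap_letters hK hc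

end Passages

end CausalKnot

namespace CausalKnot

/-! ### Coordinates of the solid line and of the dashed path. -/

section Geometry

/-- The edge is parallel to an axis. -/
def Edge.AxisParallel (e : Edge) : Prop :=
  e.start.1 = e.finish.1 ∨ e.start.2 = e.finish.2

theorem Edge.passages_eq (e : Edge) :
    e.passages = (List.range ((e.finish.1 - e.start.1).natAbs +
      (e.finish.2 - e.start.2).natAbs)).map fun m : ℕ ↦
        ⟨(e.start.1 + m * (e.finish.1 - e.start.1).sign,
          e.start.2 + m * (e.finish.2 - e.start.2).sign),
          ((e.finish.1 - e.start.1).sign, (e.finish.2 - e.start.2).sign), e.height⟩ := by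
  simp [Edge.passages, ← List.map_eq_flatMap]

theorem Edge.mem_passages_horizontal {a b c h : ℤ} {p : Passage} :
    p ∈ Edge.passages ⟨(a, b), (c, b), h⟩ ↔ p.height = h ∧ p.point.2 = b ∧ p.dir.2 = 0 ∧
      (a ≤ p.point.1 ∧ p.point.1 < c ∧ p.dir.1 = 1 ∨
        c < p.point.1 ∧ p.point.1 ≤ a ∧ p.dir.1 = -1) := by
  obtain ⟨⟨x, y⟩, ⟨dx, dy⟩, k⟩ := p
  simp only [Edge.passages_eq, List.mem_map, List.mem_range, Passage.mk.injEq, Prod.mk.injEq,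
    sub_self, Int.sign_zero, mul_zero, add_zero, Int.natAbs_zero]
  constructor
  · rintro ⟨m, hm, ⟨rfl, rfl⟩, ⟨rfl, rfl⟩, rfl⟩
    rcases lt_trichotomy (c - a) 0 with h | h | h
    · rw [Int.sign_eq_neg_one_of_neg h]; omega
    · omega
    · rw [Int.sign_eq_one_of_pos h]; omega
  · rintro ⟨rfl, rfl, rfl, h | h⟩
    · refine ⟨(x - a).toNat, ?_⟩
      rw [Int.sign_eq_one_of_pos (by omega)]; omega
    · refine ⟨(a - x).toNat, ?_⟩
      rw [Int.sign_eq_neg_one_of_neg (by omega)]; omega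

theorem Edge.mem_passages_vertical {a b d h : ℤ} {p : Passage} :
    p ∈ Edge.passages ⟨(a, b), (a, d), h⟩ ↔ p.height = h ∧ p.point.1 = a ∧ p.dir.1 = 0 ∧
      (b ≤ p.point.2 ∧ p.point.2 < d ∧ p.dir.2 = 1 ∨
        d < p.point.2 ∧ p.point.2 ≤ b ∧ p.dir.2 = -1) := by
  obtain ⟨⟨x, y⟩, ⟨dx, dy⟩, k⟩ := p
  simp only [Edge.passages_eq, List.mem_map, List.mem_range, Passage.mk.injEq, Prod.mk.injEq,
    sub_self, Int.sign_zero, mul_zero, add_zero, Int.natAbs_zero, zero_add]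
  constructor
  · rintro ⟨m, hm, ⟨rfl, rfl⟩, ⟨rfl, rfl⟩, rfl⟩
    rcases lt_trichotomy (d - b) 0 with h | h | h
    · rw [Int.sign_eq_neg_one_of_neg h]; omega
    · omega
    · rw [Int.sign_eq_one_of_pos h]; omega
  · rintro ⟨rfl, rfl, rfl, h | h⟩
    · refine ⟨(y - b).toNat, ?_⟩
      rw [Int.sign_eq_one_of_pos (by omega)]; omega
    · refine ⟨(b - y).toNat, ?_⟩
      rw [Int.sign_eq_neg_one_of_neg (by omega)]; omega

/-- Within an edge, no point is passed twice. -/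
theorem Edge.pairwise_point_ne (e : Edge) :
    e.passages.Pairwise fun p q ↦ p.point ≠ q.point := by
  rw [Edge.passages_eq, List.pairwise_map]
  refine List.pairwise_lt_range.imp_of_mem ?_
  intro m n hm hn hmn
  rw [List.mem_range] at hm
  simp only [ne_eq, Prod.mk.injEq, not_and]
  intro h1 h2
  have h3 : (m : ℤ) ≠ n := by omega
  have h1' : (e.finish.1 - e.start.1).sign = 0 := by
    by_contra h
    exact h3 (mul_right_cancel₀ h (by linarith))
  have h2' : (e.finish.2 - e.start.2).sign = 0 := by
    by_contra h
    exact h3 (mul_right_cancel₀ h (by linarith))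
  rw [Int.sign_eq_zero_iff_zero] at h1' h2'
  omega

/-- The passage `p` belongs to the dashed path between two points of the line. -/
def OnChord (s t h : ℤ) (p : Passage) : Prop :=
  p.height = h ∧ (p.point.2 = min s t ∧ p.dir.2 = 0 ∧
      (s ≤ p.point.1 ∧ p.point.1 < t ∧ p.dir.1 = 1 ∨
        t < p.point.1 ∧ p.point.1 ≤ s ∧ p.dir.1 = -1) ∨
    p.point.1 = max s t ∧ p.dir.1 = 0 ∧
      (s ≤ p.point.2 ∧ p.point.2 < t ∧ p.dir.2 = 1 ∨
        t < p.point.2 ∧ p.point.2 ≤ s ∧ p.dir.2 = -1))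

theorem mem_passages_chord {s t h : ℤ} {p : Passage} :
    p ∈ (chord s t h).flatMap Edge.passages ↔ OnChord s t h p := by
  simp only [chord, List.flatMap_cons, List.flatMap_nil, List.append_nil, List.mem_append, OnChord]
  rcases le_total s t with hst | hst
  · rw [max_eq_right hst, min_eq_left hst, Edge.mem_passages_horizontal,
      Edge.mem_passages_vertical]
    omega
  · rw [max_eq_left hst, min_eq_right hst, Edge.mem_passages_horizontal,
      Edge.mem_passages_vertical]
    omega

theorem pairwise_chord (s t h : ℤ) :
    ((chord s t h).flatMap Edge.passages).Pairwise fun p q ↦ p.point ≠ q.point := by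
  simp only [chord, List.flatMap_cons, List.flatMap_nil, List.append_nil]
  rw [List.pairwise_append]
  refine ⟨Edge.pairwise_point_ne _, Edge.pairwise_point_ne _, ?_⟩
  rcases le_total s t with hst | hst
  · rw [max_eq_right hst, min_eq_left hst]
    intro p hp q hq
    rw [Edge.mem_passages_horizontal] at hp
    rw [Edge.mem_passages_vertical] at hq
    rw [ne_eq, Prod.ext_iff]
    omega
  · rw [max_eq_left hst, min_eq_right hst]
    intro p hp q hq
    rw [Edge.mem_passages_vertical] at hp
    rw [Edge.mem_passages_horizontal] at hq
    rw [ne_eq, Prod.ext_iff]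
    omega

/-- The passage `p` belongs to the solid line. -/
def OnSolid (N : ℕ) (p : Passage) : Prop :=
  p.height = 0 ∧ ∃ i : ℤ, 0 ≤ i ∧ i ≤ N ∧
    (p.point.1 = 3 * i ∧ 3 * i ≤ p.point.2 ∧ p.point.2 < 3 * i + 3 ∧ p.dir.1 = 0 ∧ p.dir.2 = 1 ∨
      p.point.2 = 3 * i + 3 ∧ 3 * i ≤ p.point.1 ∧ p.point.1 < 3 * i + 3 ∧ p.dir.1 = 1 ∧
        p.dir.2 = 0)

theorem mem_passages_solidPart {N : ℕ} {p : Passage} :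
    p ∈ (solidPart N).flatMap Edge.passages ↔ OnSolid N p := by
  simp only [solidPart, List.flatMap_assoc, List.mem_flatMap, List.mem_range, List.flatMap_cons,
    List.flatMap_nil, List.append_nil, List.mem_append, Edge.mem_passages_vertical,
    Edge.mem_passages_horizontal, OnSolid]
  constructor
  · rintro ⟨i, hi, h⟩
    exact ⟨by omega, i, by omega, by omega, by omega⟩
  · rintro ⟨h0, i, hi, hi', h⟩
    exact ⟨i.toNat, by omega, by omega⟩

theorem pairwise_solidPart (N : ℕ) :
    ((solidPart N).flatMap Edge.passages).Pairwise fun p q ↦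
      p.point.1 + p.point.2 < q.point.1 + q.point.2 := by
  have hedge : ∀ a b c d h : ℤ, a ≤ c → b ≤ d → (Edge.passages ⟨(a, b), (c, d), h⟩).Pairwise
      fun p q ↦ p.point.1 + p.point.2 < q.point.1 + q.point.2 := by
    intro a b c d h hac hbd
    rw [Edge.passages_eq, List.pairwise_map]
    refine List.pairwise_lt_range.imp_of_mem ?_
    intro m n hm hn hmn
    rw [List.mem_range] at hm
    have h1 : 0 ≤ (c - a).sign := Int.sign_nonneg_iff.2 (by omega)
    have h2 : 0 ≤ (d - b).sign := Int.sign_nonneg_iff.2 (by omega)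
    have h3 : 0 < (c - a).sign + (d - b).sign := by
      by_contra h4
      have h5 := Int.sign_eq_zero_iff_zero.1 (show (c - a).sign = 0 by omega)
      have h6 := Int.sign_eq_zero_iff_zero.1 (show (d - b).sign = 0 by omega)
      simp only at hm
      omega
    have h4 : (m : ℤ) < n := by exact_mod_cast hmn
    show a + m * (c - a).sign + (b + m * (d - b).sign) <
      a + n * (c - a).sign + (b + n * (d - b).sign)
    nlinarith
  rw [solidPart, List.flatMap_assoc, List.pairwise_flatMap]
  constructor
  · intro i _
    simp only [List.flatMap_cons, List.flatMap_nil, List.append_nil, List.pairwise_append]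
    refine ⟨hedge _ _ _ _ _ (by omega) (by omega), hedge _ _ _ _ _ (by omega) (by omega), ?_⟩
    intro p hp q hq
    rw [Edge.mem_passages_vertical] at hp
    rw [Edge.mem_passages_horizontal] at hq
    omega
  · refine List.pairwise_lt_range.imp ?_
    intro i j hij p hp q hq
    simp only [List.flatMap_cons, List.flatMap_nil, List.append_nil, List.mem_append,
      Edge.mem_passages_vertical, Edge.mem_passages_horizontal] at hp hq
    omega

/-- The dashed path at the vertex at position `i`, on its way under the solid line. -/
def windIn (i : ℕ) : Edge := ⟨(3 * i - 1, 3 * i - 1), (3 * i - 1, 3 * i + 1), -1⟩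

/-- The dashed path at the vertex at position `i`, on its way back. -/
def windOut (i : ℕ) (h : ℤ) : Edge := ⟨(3 * i - 1, 3 * i + 1), (3 * i + 1, 3 * i + 1), h⟩

/-- The dashed path through the vertices `qs` to the upper side of the solid line at the last
vertex `n`. -/
def dashedInit (h s : ℤ) (n : ℕ) : List ℕ → List Edge
  | [] => chord s (3 * n - 1) h ++ [windIn n]
  | i :: qs => chord s (3 * i - 1) h ++ [windIn i, windOut i 1] ++
      dashedInit (h + 1) (3 * i + 1) n qs

/-- The last part of the dashed path, which passes under everything. -/
def lastStrand (n : ℕ) : List Edge := windOut n (-1) :: chord (3 * n + 1) 0 (-1)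

theorem dashedPart_append_singleton (h s : ℤ) (n : ℕ) (qs : List ℕ) :
    dashedPart h s (qs ++ [n]) = dashedInit h s n qs ++ lastStrand n := by
  induction qs generalizing h s with
  | nil => simp [dashedPart, dashedInit, lastStrand, windIn, windOut]
  | cons i qs ih => simp [dashedPart, dashedInit, windIn, windOut, ih]

/-- The passage `p` belongs to `windIn i`. -/
def OnWindIn (i : ℕ) (p : Passage) : Prop :=
  p.height = -1 ∧ p.point.1 = 3 * i - 1 ∧ 3 * i - 1 ≤ p.point.2 ∧ p.point.2 ≤ 3 * i ∧
    p.dir.1 = 0 ∧ p.dir.2 = 1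

/-- The passage `p` belongs to `windOut i h`. -/
def OnWindOut (i : ℕ) (h : ℤ) (p : Passage) : Prop :=
  p.height = h ∧ p.point.2 = 3 * i + 1 ∧ 3 * i - 1 ≤ p.point.1 ∧ p.point.1 ≤ 3 * i ∧
    p.dir.1 = 1 ∧ p.dir.2 = 0

theorem mem_passages_windIn {i : ℕ} {p : Passage} :
    p ∈ (windIn i).passages ↔ OnWindIn i p := by
  rw [windIn, Edge.mem_passages_vertical, OnWindIn]
  omega

theorem mem_passages_windOut {i : ℕ} {h : ℤ} {p : Passage} :
    p ∈ (windOut i h).passages ↔ OnWindOut i h p := by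
  rw [windOut, Edge.mem_passages_horizontal, OnWindOut]
  omega

/-- A coarse description that suffices for the coordinate arguments: chords end at coordinates 3 j -
1 and, apart from the first, start at 3 i + 1, so residues modulo 3 tell the pieces apart. -/
theorem of_mem_dashedInit {h s : ℤ} {n : ℕ} {qs : List ℕ} {p : Passage}
    (hp : p ∈ (dashedInit h s n qs).flatMap Edge.passages) :
    (∃ s' h', ∃ j ∈ n :: qs, OnChord s' (3 * j - 1) h' p ∧ h ≤ h' ∧
        (s' = s ∨ ∃ i ∈ qs, s' = 3 * i + 1)) ∨
      (∃ j ∈ n :: qs, OnWindIn j p) ∨ ∃ j ∈ qs, OnWindOut j 1 p := by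
  induction qs generalizing h s with
  | nil =>
    rw [dashedInit, List.flatMap_append, List.mem_append, mem_passages_chord, List.flatMap_singleton,
      mem_passages_windIn] at hp
    rcases hp with hp | hp
    · exact Or.inl ⟨s, h, n, by simp, hp, le_rfl, Or.inl rfl⟩
    · exact Or.inr (Or.inl ⟨n, by simp, hp⟩)
  | cons i qs ih =>
    simp only [dashedInit, List.flatMap_append, List.mem_append, mem_passages_chord,
      List.flatMap_cons, List.flatMap_nil, List.append_nil, mem_passages_windIn,
      mem_passages_windOut] at hp
    rcases hp with (hp | hp | hp) | hp
    · exact Or.inl ⟨s, h, i, by simp, hp, le_rfl, Or.inl rfl⟩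
    · exact Or.inr (Or.inl ⟨i, by simp, hp⟩)
    · exact Or.inr (Or.inr ⟨i, by simp, hp⟩)
    · rcases ih hp with ⟨s', h', j, hj, hc, hh, hs⟩ | ⟨j, hj, hc⟩ | ⟨j, hj, hc⟩
      · refine Or.inl ⟨s', h', j, by simp at hj ⊢; tauto, hc, by omega, Or.inr ?_⟩
        rcases hs with rfl | ⟨k, hk, rfl⟩
        · exact ⟨i, by simp, rfl⟩
        · exact ⟨k, by simp [hk], rfl⟩
      · exact Or.inr (Or.inl ⟨j, by simp at hj ⊢; tauto, hc⟩)
      · exact Or.inr (Or.inr ⟨j, by simp [hj], hc⟩)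

/-- Transversal passages, the later of which is above the earlier. -/
def CrossesOver (p q : Passage) : Prop :=
  p.point = q.point → p.height < q.height ∧ (p.dir.1 = 0 ↔ q.dir.1 ≠ 0)

/-- A chord is a hook with horizontal leg at the smaller and vertical leg at the larger of its end
coordinates. If two chords share no end, no two parallel legs are collinear, so they meet only at
right angles. -/
theorem OnChord.crossesOver {s t h s' t' h' : ℤ} {p q : Passage} (hp : OnChord s t h p)
    (hq : OnChord s' t' h' q) (h1 : s ≠ s') (h2 : s ≠ t') (h3 : t ≠ s') (h4 : t ≠ t')
    (hh : h < h') : CrossesOver p q := by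
  intro e
  rw [Prod.ext_iff] at e
  unfold OnChord at hp hq
  omega

/-- The height grows by one from chord to chord, so later chords are over earlier ones, and the
windings meet no other piece of the dashed path. The conditions on `s` keep the starting point away
from the ends of all later chords. -/
theorem pairwise_dashedInit {h s : ℤ} {n : ℕ} {qs : List ℕ} (hn : (n :: qs).Nodup)
    (hs0 : 0 < s) (hs : s % 3 ≠ 2) (hsq : ∀ j ∈ n :: qs, s ≠ 3 * j + 1) :
    ((dashedInit h s n qs).flatMap Edge.passages).Pairwise CrossesOver := by
  induction qs generalizing h s with
  | nil =>
    rw [dashedInit, List.flatMap_append, List.flatMap_singleton, List.pairwise_append]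
    refine ⟨(pairwise_chord _ _ _).imp fun h e ↦ absurd e h,
      (Edge.pairwise_point_ne _).imp fun h e ↦ absurd e h, ?_⟩
    intro p hp q hq e
    rw [mem_passages_chord, OnChord] at hp
    rw [mem_passages_windIn, OnWindIn] at hq
    rw [Prod.ext_iff] at e
    omega
  | cons i qs ih =>
    simp only [dashedInit, List.flatMap_append, List.flatMap_cons, List.flatMap_nil,
      List.append_nil, List.append_assoc]
    have hni : n ≠ i := by rintro rfl; simp at hn
    have hiq : i ∉ qs := by simp only [List.nodup_cons] at hn; tauto
    have hn' : (n :: qs).Nodup := by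
      simp only [List.nodup_cons, List.mem_cons] at hn ⊢; tauto
    have hi : ∀ j ∈ n :: qs, j ≠ i := by
      rintro j hj rfl
      simp only [List.mem_cons] at hj; tauto
    have hsi := hsq i (by simp)
    rw [List.pairwise_append, List.pairwise_append, List.pairwise_append]
    refine ⟨(pairwise_chord _ _ _).imp fun h e ↦ absurd e h,
      ⟨(Edge.pairwise_point_ne _).imp fun h e ↦ absurd e h,
      ⟨(Edge.pairwise_point_ne _).imp fun h e ↦ absurd e h,
        ih hn' (by omega) (by omega) ?_, ?_⟩, ?_⟩, ?_⟩
    · intro j hj e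
      exact hi j hj (by omega)
    · intro p hp q hq e
      rw [mem_passages_windOut, OnWindOut] at hp
      rw [Prod.ext_iff] at e
      rcases of_mem_dashedInit hq with ⟨s', h', j, hj, hc, hh, hs'⟩ | ⟨j, hj, hc⟩ | ⟨j, hj, hc⟩
      · clear hs'
        unfold OnChord at hc
        omega
      · have := hi j hj
        unfold OnWindIn at hc
        omega
      · have := hi j (by simp [hj])
        unfold OnWindOut at hc
        omega
    · intro p hp q hq e
      rw [mem_passages_windIn, OnWindIn] at hp
      rw [Prod.ext_iff] at e
      rw [List.mem_append, mem_passages_windOut] at hq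
      rcases hq with hq | hq
      · unfold OnWindOut at hq
        omega
      rcases of_mem_dashedInit hq with ⟨s', h', j, hj, hc, hh, hs'⟩ | ⟨j, hj, hc⟩ | ⟨j, hj, hc⟩
      · unfold OnChord at hc
        rcases hs' with rfl | ⟨k, hk, rfl⟩ <;> omega
      · have := hi j hj
        unfold OnWindIn at hc
        omega
      · have := hi j (by simp [hj])
        unfold OnWindOut at hc
        omega
    · intro p hp q hq
      rw [mem_passages_chord] at hp
      rw [List.mem_append, List.mem_append, mem_passages_windIn, mem_passages_windOut] at hq
      rcases hq with hq | hq | hq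
      · intro e
        rw [Prod.ext_iff] at e
        unfold OnChord at hp
        unfold OnWindIn at hq
        omega
      · intro e
        rw [Prod.ext_iff] at e
        unfold OnChord at hp
        unfold OnWindOut at hq
        omega
      rcases of_mem_dashedInit hq with ⟨s', h', j, hj, hc, hh, hs'⟩ | ⟨j, hj, hc⟩ | ⟨j, hj, hc⟩
      · have := hi j hj
        refine hp.crossesOver hc ?_ ?_ ?_ ?_ (by clear hs'; omega)
        · rcases hs' with rfl | ⟨k, hk, rfl⟩
          · exact hsi
          · exact hsq k (by simp [hk])
        · clear hs'
          omega
        · rcases hs' with rfl | ⟨k, hk, rfl⟩ <;> omega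
        · clear hs'
          omega
      · intro e
        rw [Prod.ext_iff] at e
        unfold OnChord at hp
        unfold OnWindIn at hc
        omega
      · intro e
        rw [Prod.ext_iff] at e
        unfold OnChord at hp
        unfold OnWindOut at hc
        omega

end Geometry

end CausalKnot

namespace CausalKnot

/-! ### The crossings of the diagram and which strand is over. -/

section Crossings

/-- The solid line over the dashed path, on its way up at the vertex at position `j`. -/
def upOver (j : ℕ) : Passage := ⟨(3 * j - 1, 3 * j), (1, 0), 0⟩

/-- The dashed path under the solid line, on its way up at the vertex at position `j`. -/
def upUnder (j : ℕ) : Passage := ⟨(3 * j - 1, 3 * j), (0, 1), -1⟩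

/-- The solid line under the dashed path, on its way down at the vertex at position `j`. -/
def downUnder (j : ℕ) : Passage := ⟨(3 * j, 3 * j + 1), (0, 1), 0⟩

/-- The dashed path over the solid line, on its way down at the vertex at position `j`. -/
def downOver (j : ℕ) : Passage := ⟨(3 * j, 3 * j + 1), (1, 0), 1⟩

theorem Passage.eq_iff {p q : Passage} : p = q ↔ p.point.1 = q.point.1 ∧ p.point.2 = q.point.2 ∧
    p.dir.1 = q.dir.1 ∧ p.dir.2 = q.dir.2 ∧ p.height = q.height := by
  obtain ⟨⟨a, b⟩, ⟨c, d⟩, h⟩ := p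
  obtain ⟨⟨a', b'⟩, ⟨c', d'⟩, h'⟩ := q
  simp only [Passage.mk.injEq, Prod.mk.injEq]
  tauto

/-- The passages through the solid line and the dashed path up to its last vertex. -/
def initialPassages (N n : ℕ) (qs : List ℕ) : List Passage :=
  (solidPart N).flatMap Edge.passages ++
    (dashedInit 1 (3 * N + 3) n qs).flatMap Edge.passages

/-- The passages through the last part of the dashed path. -/
def finalPassages (n : ℕ) : List Passage := (lastStrand n).flatMap Edge.passages

theorem mem_finalPassages {n : ℕ} {p : Passage} :
    p ∈ finalPassages n ↔ OnWindOut n (-1) p ∨ OnChord (3 * n + 1) 0 (-1) p := by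
  rw [finalPassages, lastStrand, List.flatMap_cons, List.mem_append, mem_passages_windOut,
    mem_passages_chord]

theorem passages_knotOfPositions (n : ℕ) (qs : List ℕ) :
    (knotOfPositions (qs ++ [n])).flatMap Edge.passages =
      initialPassages (qs ++ [n]).length n qs ++ finalPassages n := by
  rw [knotOfPositions, dashedPart_append_singleton, List.flatMap_append, List.flatMap_append,
    initialPassages, finalPassages, List.append_assoc]

variable {N n : ℕ} {qs : List ℕ}

theorem height_of_mem_dashedInit {h s : ℤ} {p : Passage} (hh : 1 ≤ h)
    (hp : p ∈ (dashedInit h s n qs).flatMap Edge.passages) : p.height = -1 ∨ 1 ≤ p.height := by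
  rcases of_mem_dashedInit hp with ⟨s', h', j, -, hc, hh, -⟩ | ⟨j, -, hc⟩ | ⟨j, -, hc⟩
  · unfold OnChord at hc; omega
  · unfold OnWindIn at hc; omega
  · unfold OnWindOut at hc; omega

/-- The staircase stays on or above the diagonal, the chords on or below it. On the diagonal the
staircase has only multiples of 3 up to 3 N, which the chords avoid; so only the windings meet the
solid line. -/
theorem eq_of_solid_of_dashedInit (hq : ∀ j ∈ n :: qs, 1 ≤ j ∧ j ≤ N) {p q : Passage}
    (hp : OnSolid N p) (hqd : q ∈ (dashedInit 1 (3 * N + 3) n qs).flatMap Edge.passages)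
    (e : p.point = q.point) :
    (∃ j ∈ n :: qs, p = upOver j ∧ q = upUnder j) ∨
      ∃ j ∈ qs, p = downUnder j ∧ q = downOver j := by
  obtain ⟨h0, i, hi, hiN, hp⟩ := hp
  rw [Prod.ext_iff] at e
  rcases of_mem_dashedInit hqd with ⟨s', h', j, hj, hc, hh, hs⟩ | ⟨j, hj, hc⟩ | ⟨j, hj, hc⟩
  · exfalso
    have := hq j hj
    unfold OnChord at hc
    rcases hs with rfl | ⟨k, -, rfl⟩ <;> omega
  · refine Or.inl ⟨j, hj, ?_⟩
    unfold OnWindIn at hc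
    simp only [Passage.eq_iff, upOver, upUnder]
    omega
  · refine Or.inr ⟨j, hj, ?_⟩
    unfold OnWindOut at hc
    simp only [Passage.eq_iff, downUnder, downOver]
    omega

/-- The passages of the first part on the boundary of the square cut off by the last part. -/
theorem of_max_eq (hn : (n :: qs).Nodup) (hq : ∀ j ∈ n :: qs, 1 ≤ j ∧ j ≤ N) {p : Passage}
    (hp : p ∈ initialPassages N n qs) (hmax : max p.point.1 p.point.2 = 3 * n + 1) :
    p = downUnder n ∨ p.point.1 = 3 * n + 1 ∧ 0 < p.point.2 ∧ p.point.2 < 3 * n + 1 ∧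
      p.dir.2 = 0 ∧ (p.dir.1 = 1 ∨ p.dir.1 = -1) ∧ 1 ≤ p.height := by
  have hnN := hq n (by simp)
  rw [initialPassages, List.mem_append, mem_passages_solidPart] at hp
  rcases hp with ⟨h0, i, hi, hiN, hp⟩ | hp
  · left
    simp only [Passage.eq_iff, downUnder]
    omega
  · right
    have hnq : ∀ j ∈ qs, j ≠ n := by
      rintro j hj rfl
      simp [hj] at hn
    rcases of_mem_dashedInit hp with ⟨s', h', j, hj, hc, hh, hs⟩ | ⟨j, hj, hc⟩ | ⟨j, hj, hc⟩
    · have := hq j hj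
      unfold OnChord at hc
      rcases hs with rfl | ⟨k, hk, rfl⟩
      · omega
      · have := hnq k hk
        omega
    · unfold OnWindIn at hc
      omega
    · have := hnq j hj
      unfold OnWindOut at hc
      omega

theorem max_eq_of_mem_of_mem (hq : ∀ j ∈ n :: qs, 1 ≤ j ∧ j ≤ N) {p q : Passage}
    (hp : p ∈ initialPassages N n qs) (hqf : q ∈ finalPassages n) (e : p.point = q.point) :
    max p.point.1 p.point.2 = 3 * n + 1 := by
  rw [Prod.ext_iff] at e
  rw [mem_finalPassages] at hqf
  -- The last strand returns along the lower side of the square at positive abscissas, where the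
  -- first part has no passage.
  have hy : p.point.2 = 0 → p.point.1 ≤ 0 := by
    intro h0
    rw [initialPassages, List.mem_append, mem_passages_solidPart] at hp
    rcases hp with ⟨-, i, hi, hiN, hp⟩ | hp
    · omega
    · rcases of_mem_dashedInit hp with ⟨s', h', j, hj, hc, hh, hs⟩ | ⟨j, hj, hc⟩ | ⟨j, hj, hc⟩
      · have := hq j hj
        unfold OnChord at hc
        rcases hs with rfl | ⟨k, hk, rfl⟩ <;> omega
      · have := hq j hj
        unfold OnWindIn at hc
        omega
      · unfold OnWindOut at hc
        omega
  unfold OnWindOut OnChord at hqf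
  omega

theorem transversal_of_mem_of_mem (hn : (n :: qs).Nodup) (hq : ∀ j ∈ n :: qs, 1 ≤ j ∧ j ≤ N)
    {p q : Passage} (hp : p ∈ initialPassages N n qs) (hqf : q ∈ finalPassages n) :
    Transversal p q := by
  intro e
  have hmax := max_eq_of_mem_of_mem hq hp hqf e
  rw [Prod.ext_iff] at e
  rw [mem_finalPassages] at hqf
  unfold OnWindOut OnChord at hqf
  rcases of_max_eq hn hq hp hmax with rfl | h
  · simp only [downUnder, true_iff] at e ⊢
    omega
  · omega

theorem pairwise_finalPassages (n : ℕ) :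
    (finalPassages n).Pairwise fun p q ↦ p.point ≠ q.point := by
  rw [finalPassages, lastStrand, List.flatMap_cons, List.pairwise_append]
  refine ⟨Edge.pairwise_point_ne _, pairwise_chord _ _ _, ?_⟩
  intro p hp q hq
  rw [mem_passages_windOut, OnWindOut] at hp
  rw [mem_passages_chord, OnChord] at hq
  rw [ne_eq, Prod.ext_iff]
  omega

theorem CrossesOver.transversal {p q : Passage} (h : CrossesOver p q) : Transversal p q :=
  fun e ↦ ⟨(h e).1.ne, (h e).2⟩

theorem pairwise_dashedInit_three_mul (hn : (n :: qs).Nodup)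
    (hq : ∀ j ∈ n :: qs, 1 ≤ j ∧ j ≤ N) :
    ((dashedInit 1 (3 * N + 3) n qs).flatMap Edge.passages).Pairwise CrossesOver :=
  pairwise_dashedInit hn (by omega) (by omega) fun j hj ↦ by have := hq j hj; omega

theorem pairwise_transversal (hn : (n :: qs).Nodup) (hq : ∀ j ∈ n :: qs, 1 ≤ j ∧ j ≤ N) :
    (initialPassages N n qs ++ finalPassages n).Pairwise Transversal := by
  rw [List.pairwise_append]
  refine ⟨?_, (pairwise_finalPassages n).imp fun h e ↦ absurd e h,
    fun p hp q hqf ↦ transversal_of_mem_of_mem hn hq hp hqf⟩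
  rw [initialPassages, List.pairwise_append]
  refine ⟨(pairwise_solidPart N).imp fun h e ↦ ?_,
    (pairwise_dashedInit_three_mul hn hq).imp CrossesOver.transversal, ?_⟩
  · rw [Prod.ext_iff] at e
    omega
  · intro p hp q hqd e
    rcases eq_of_solid_of_dashedInit hq (mem_passages_solidPart.1 hp) hqd e with
      ⟨j, -, rfl, rfl⟩ | ⟨j, -, rfl, rfl⟩ <;> simp [upOver, upUnder, downOver, downUnder]

/-- The first part of the diagram: crossings at which the later passage is not above the earlier
one are those of the solid line over the dashed path. -/
theorem pairwise_initialPassages (hn : (n :: qs).Nodup) (hq : ∀ j ∈ n :: qs, 1 ≤ j ∧ j ≤ N) :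
    (initialPassages N n qs).Pairwise fun p q ↦ p.point = q.point →
      p.height < q.height ∨ ∃ j ∈ n :: qs, p = upOver j ∧ q = upUnder j := by
  rw [initialPassages, List.pairwise_append]
  refine ⟨(pairwise_solidPart N).imp fun h e ↦ ?_,
    (pairwise_dashedInit_three_mul hn hq).imp fun h e ↦ Or.inl (h e).1, ?_⟩
  · rw [Prod.ext_iff] at e
    omega
  · intro p hp q hqd e
    rcases eq_of_solid_of_dashedInit hq (mem_passages_solidPart.1 hp) hqd e with
      h | ⟨j, -, rfl, rfl⟩
    · exact Or.inr h
    · exact Or.inl (by simp [downOver, downUnder])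

/-- The passages at height `0` are those of the solid line, and come first. -/
theorem pairwise_initialPassages_of_height_eq_zero (N n : ℕ) (qs : List ℕ) :
    (initialPassages N n qs).Pairwise fun p q ↦ q.height = 0 →
      p.height = 0 ∧ p.point.1 + p.point.2 < q.point.1 + q.point.2 := by
  rw [initialPassages, List.pairwise_append]
  refine ⟨(pairwise_solidPart N).imp_of_mem fun hp hq h _ ↦
    ⟨(mem_passages_solidPart.1 hp).1, h⟩, ?_, ?_⟩
  · refine List.Pairwise.imp_of_mem (R := fun _ _ ↦ True) ?_ (List.pairwise_of_forall (by simp))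
    intro p q _ hq _ h0
    have := height_of_mem_dashedInit le_rfl hq
    omega
  · intro p _ q hq h0
    have := height_of_mem_dashedInit le_rfl hq
    omega

end Crossings

end CausalKnot

namespace CausalKnot

/-! ### A closed loop enters and leaves the square bounded by the last strand equally often. -/

section Telescoping

/-- The passage `q` may come next after `p` on a path whose corners satisfy `C`. -/
def Follows (C : ℤ × ℤ → Prop) (p q : Passage) : Prop :=
  q.point = p.point + p.dir ∧ (q.dir = p.dir ∨ C q.point)

/-- The axis-parallel edges `L` form a path from `a` to `b`. -/
def IsPath (a : ℤ × ℤ) : List Edge → ℤ × ℤ → Prop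
  | [], b => a = b
  | e :: L, b => e.start = a ∧ e.AxisParallel ∧ e.start ≠ e.finish ∧ IsPath e.finish L b

theorem IsPath.append {a b c : ℤ × ℤ} {L L' : List Edge} (h : IsPath a L b) (h' : IsPath b L' c) :
    IsPath a (L ++ L') c := by
  induction L generalizing a with
  | nil => cases h; exact h'
  | cons e L ih => exact ⟨h.1, h.2.1, h.2.2.1, ih h.2.2.2⟩

theorem Edge.length_passages_pos {e : Edge} (h : e.start ≠ e.finish) :
    0 < (e.finish.1 - e.start.1).natAbs + (e.finish.2 - e.start.2).natAbs := by
  rw [ne_eq, Prod.ext_iff] at h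
  omega

theorem Edge.point_of_mem_head? {e : Edge} {p : Passage} (hp : p ∈ e.passages.head?) :
    p.point = e.start := by
  rw [Edge.passages_eq, List.head?_map, List.head?_range] at hp
  split_ifs at hp
  · simp at hp
  · simp only [Option.map_some, Option.mem_def, Option.some.injEq] at hp
    subst hp
    simp

theorem Edge.point_add_dir_of_mem_getLast? {e : Edge} (h : e.AxisParallel) {p : Passage}
    (hp : p ∈ e.passages.getLast?) : p.point + p.dir = e.finish := by
  rw [Edge.passages_eq, List.getLast?_map, List.getLast?_range] at hp
  split_ifs at hp with h0
  · simp at hp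
  · simp only [Option.map_some, Option.mem_def, Option.some.injEq] at hp
    subst hp
    have h1 := Int.sign_mul_natAbs (e.finish.1 - e.start.1)
    have h2 := Int.sign_mul_natAbs (e.finish.2 - e.start.2)
    rw [Nat.cast_sub (by omega), Nat.cast_add]
    rcases h with h | h
    · rw [h, sub_self] at *
      ext
      · simp
      · simp only [Prod.snd_add, Int.natAbs_zero, Nat.cast_zero, Nat.cast_one]
        linarith
    · rw [h, sub_self] at *
      ext
      · simp only [Prod.fst_add, Int.natAbs_zero, Nat.cast_zero, Nat.cast_one]
        linarith
      · simp

theorem Edge.isChain_passages (C : ℤ × ℤ → Prop) (e : Edge) :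
    e.passages.IsChain (Follows C) := by
  rw [Edge.passages_eq, List.isChain_map, List.isChain_range]
  intro m _
  refine ⟨?_, Or.inl rfl⟩
  ext
  · simp; ring
  · simp; ring

theorem IsPath.isChain_passages {C : ℤ × ℤ → Prop} {a b : ℤ × ℤ} {L : List Edge}
    (h : IsPath a L b) (hC : ∀ e ∈ L, C e.start) :
    (L.flatMap Edge.passages).IsChain (Follows C) ∧
      ∀ p ∈ (L.flatMap Edge.passages).head?, p.point = a ∧ C p.point := by
  induction L generalizing a with
  | nil => simp
  | cons e L ih =>
    obtain ⟨rfl, h1, h2, h3⟩ := h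
    obtain ⟨ih1, ih2⟩ := ih h3 fun e he ↦ hC e (List.mem_cons_of_mem _ he)
    rw [List.flatMap_cons, List.isChain_append]
    refine ⟨⟨e.isChain_passages C, ih1, ?_⟩, ?_⟩
    · intro p hp q hq
      obtain ⟨hq1, hq2⟩ := ih2 q hq
      exact ⟨by rw [hq1, Edge.point_add_dir_of_mem_getLast? h1 hp], Or.inr hq2⟩
    · intro p hp
      have hne : e.passages ≠ [] := by
        rw [Edge.passages_eq, ne_eq, List.map_eq_nil_iff, List.range_eq_nil]
        exact (Edge.length_passages_pos h2).ne'
      rw [List.head?_append_of_ne_nil _ hne] at hp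
      have := Edge.point_of_mem_head? hp
      exact ⟨this, this ▸ hC e (by simp)⟩

theorem isPath_chord {s t : ℤ} (h : ℤ) (hst : s ≠ t) : IsPath (s, s) (chord s t h) (t, t) := by
  simp only [chord, IsPath, Edge.AxisParallel, ne_eq, Prod.mk.injEq, true_and, and_true]
  omega

theorem isPath_windIn (i : ℕ) :
    IsPath (3 * i - 1, 3 * i - 1) [windIn i] (3 * i - 1, 3 * i + 1) := by
  simp only [windIn, IsPath, Edge.AxisParallel, ne_eq, Prod.mk.injEq, true_and, and_true,
    true_or]
  omega

theorem isPath_windOut (i : ℕ) (h : ℤ) :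
    IsPath (3 * i - 1, 3 * i + 1) [windOut i h] (3 * i + 1, 3 * i + 1) := by
  simp only [windOut, IsPath, Edge.AxisParallel, ne_eq, Prod.mk.injEq, true_and, and_true,
    or_true]
  omega

theorem isPath_solidPart (N : ℕ) : IsPath (0, 0) (solidPart N) (3 * N + 3, 3 * N + 3) := by
  have h : ∀ m : ℕ, IsPath (0, 0) ((List.range m).flatMap fun i : ℕ ↦
      [⟨(3 * i, 3 * i), (3 * i, 3 * i + 3), 0⟩, ⟨(3 * i, 3 * i + 3), (3 * i + 3, 3 * i + 3), 0⟩])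
      (3 * (m : ℤ), 3 * (m : ℤ)) := by
    intro m
    induction m with
    | zero => simp [IsPath]
    | succ m ih =>
      rw [List.range_succ, List.flatMap_append, List.flatMap_singleton]
      refine ih.append ?_
      simp only [IsPath, Edge.AxisParallel, ne_eq, Prod.mk.injEq, true_and, and_true, true_or,
        or_true]
      push_cast
      omega
  have := h (N + 1)
  push_cast at this
  exact this

theorem isPath_dashedInit {h s : ℤ} (n : ℕ) (qs : List ℕ) (hs : s % 3 ≠ 2) :
    IsPath (s, s) (dashedInit h s n qs) (3 * n - 1, 3 * n + 1) := by
  induction qs generalizing h s with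
  | nil => exact (isPath_chord h (by omega)).append (isPath_windIn n)
  | cons i qs ih =>
    exact ((isPath_chord h (by omega)).append ((isPath_windIn i).append (isPath_windOut i 1))).append
      (ih (by omega))

variable {N n : ℕ} {qs : List ℕ}

theorem max_start_solidPart {e : Edge} (he : e ∈ solidPart N) :
    max e.start.1 e.start.2 ≠ 3 * n + 1 := by
  simp only [solidPart, List.mem_flatMap, List.mem_range, List.mem_cons, List.not_mem_nil,
    or_false] at he
  obtain ⟨i, -, rfl | rfl⟩ := he <;> simp only <;> omega

theorem max_start_dashedInit {h s : ℤ} (hn : n ∉ qs) (hs : s ≠ 3 * n + 1) {e : Edge}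
    (he : e ∈ dashedInit h s n qs) : max e.start.1 e.start.2 ≠ 3 * n + 1 := by
  induction qs generalizing h s with
  | nil =>
    simp only [dashedInit, chord, windIn, List.cons_append, List.nil_append, List.mem_cons,
      List.not_mem_nil, or_false] at he
    rcases he with rfl | rfl | rfl <;> simp only <;> omega
  | cons i qs ih =>
    rw [List.mem_cons, not_or] at hn
    simp only [dashedInit, chord, windIn, windOut, List.cons_append, List.nil_append,
      List.mem_cons] at he
    rcases he with rfl | rfl | rfl | rfl | he
    any_goals simp only; omega
    exact ih hn.2 (by omega) he

/-- No corner of the first part has maximal coordinate 3 n + 1, so a path that reaches this side of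
the square goes straight through it. -/
theorem isChain_initialPassages (hn : n ∉ qs) :
    (initialPassages N n qs).IsChain (Follows fun x ↦ max x.1 x.2 ≠ 3 * n + 1) := by
  rw [initialPassages, ← List.flatMap_append]
  refine (((isPath_solidPart N).append
    (isPath_dashedInit (h := 1) n qs (by omega))).isChain_passages ?_).1
  intro e he
  rw [List.mem_append] at he
  rcases he with he | he
  · exact max_start_solidPart he
  · exact max_start_dashedInit hn (by omega) he

/-- The direction of the crossing of the boundary of the square with corner `3 n + 1`. -/
def outward (n : ℕ) (p : Passage) : ℤ :=
  if max p.point.1 p.point.2 = 3 * n + 1 then p.dir.1 + p.dir.2 else 0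

/-- The passage `p` comes from outside of the square with corner `3 n + 1`. -/
def fromOutside (n : ℕ) (p : Passage) : ℤ :=
  if 3 * n + 1 < max p.point.1 p.point.2 ∨
    max p.point.1 p.point.2 = 3 * n + 1 ∧ p.dir.1 + p.dir.2 < 0 then 1 else 0

theorem dir_of_mem_initialPassages {p : Passage} (hp : p ∈ initialPassages N n qs) :
    p.dir.1 = 0 ∧ (p.dir.2 = 1 ∨ p.dir.2 = -1) ∨ p.dir.2 = 0 ∧ (p.dir.1 = 1 ∨ p.dir.1 = -1) := by
  rw [initialPassages, List.mem_append, mem_passages_solidPart] at hp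
  rcases hp with ⟨-, i, -, -, hp⟩ | hp
  · omega
  · rcases of_mem_dashedInit hp with ⟨s', h', j, -, hc, -⟩ | ⟨j, -, hc⟩ | ⟨j, -, hc⟩
    · unfold OnChord at hc
      omega
    · unfold OnWindIn at hc
      omega
    · unfold OnWindOut at hc
      omega

/-- On the boundary, `fromOutside` records the side from which the path arrives, as told by its
direction. The value therefore changes exactly one step after a boundary passage, by the amount
`outward`. -/
theorem fromOutside_of_follows (hn : (n :: qs).Nodup) (hq : ∀ j ∈ n :: qs, 1 ≤ j ∧ j ≤ N)
    {p q : Passage} (hp : p ∈ initialPassages N n qs) (hqm : q ∈ initialPassages N n qs)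
    (h : Follows (fun x ↦ max x.1 x.2 ≠ 3 * n + 1) p q) :
    fromOutside n q = fromOutside n p + outward n p := by
  obtain ⟨h1, h2⟩ := h
  rw [Prod.ext_iff, Prod.fst_add, Prod.snd_add] at h1
  rw [Prod.ext_iff] at h2
  have hpd := dir_of_mem_initialPassages hp
  unfold fromOutside outward
  by_cases hpm : max p.point.1 p.point.2 = 3 * n + 1
  · rcases of_max_eq hn hq hp hpm with rfl | h3
    · have hx : (downUnder n).point.1 = 3 * n := rfl
      have hy : (downUnder n).point.2 = 3 * n + 1 := rfl
      have hdx : (downUnder n).dir.1 = 0 := rfl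
      have hdy : (downUnder n).dir.2 = 1 := rfl
      rw [if_pos (by omega), if_neg (by omega), if_pos (by omega)]
      omega
    · rw [if_pos hpm]
      rcases h3.2.2.2.2.1 with h4 | h4
      · rw [if_pos (by omega), if_neg (by omega)]
        omega
      · rw [if_neg (by omega), if_pos (by omega)]
        omega
  · rw [if_neg hpm, add_zero]
    by_cases hqm' : max q.point.1 q.point.2 = 3 * n + 1
    · rcases of_max_eq hn hq hqm hqm' with rfl | h3
      · have hx : (downUnder n).point.1 = 3 * n := rfl
        have hy : (downUnder n).point.2 = 3 * n + 1 := rfl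
        have hdx : (downUnder n).dir.1 = 0 := rfl
        have hdy : (downUnder n).dir.2 = 1 := rfl
        rw [if_neg (by omega), if_neg (by omega)]
      · rcases h3.2.2.2.2.1 with h4 | h4
        · rw [if_neg (by omega), if_neg (by omega)]
        · rw [if_pos (by omega), if_pos (by omega)]
    · congr 1
      rw [eq_iff_iff]
      omega

theorem sum_eq_sub_of_isChain {f g : Passage → ℤ} {p q : Passage} {v : List Passage}
    (h : (p :: (v ++ [q])).IsChain fun r s ↦ f s = f r + g r) :
    g p + (v.map g).sum = f q - f p := by
  induction v generalizing p with
  | nil =>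
    simp at h
    simp [h]
  | cons r v ih =>
    rw [List.cons_append, List.isChain_cons_cons] at h
    have := ih h.2
    rw [List.map_cons, List.sum_cons, this, h.1]
    ring

theorem underSum_eq_sum (v x : List Passage) :
    underSum v x = (v.map fun s ↦ (x.map fun r ↦
      if s.point = r.point ∧ r.height < s.height then crossingSign s.dir r.dir else 0).sum).sum := by
  induction x with
  | nil => simp [underSum]
  | cons r x ih =>
    simp only [List.map_cons, List.sum_cons]
    rw [List.sum_map_add, ← ih]
    simp [underSum]

theorem underSum_append (v x y : List Passage) :
    underSum v (x ++ y) = underSum v x + underSum v y := by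
  simp [underSum]

/-- The last strand runs clockwise, along the top to the right and then down the right side. A
strand over it that leaves the square makes a crossing of sign -1, one that enters a crossing of
sign +1. -/
theorem sum_finalPassages (hn : (n :: qs).Nodup) (hq : ∀ j ∈ n :: qs, 1 ≤ j ∧ j ≤ N)
    {s : Passage} (hs : s ∈ initialPassages N n qs) :
    ((finalPassages n).map fun r ↦ if s.point = r.point ∧ r.height < s.height then
      crossingSign s.dir r.dir else 0).sum = -outward n s := by
  unfold outward
  split_ifs with hmax
  · have key : ∀ r ∈ finalPassages n, s.point = r.point → r.height < s.height →
        crossingSign s.dir r.dir = -(s.dir.1 + s.dir.2) →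
        ((finalPassages n).map fun r ↦ if s.point = r.point ∧ r.height < s.height then
          crossingSign s.dir r.dir else 0).sum = -(s.dir.1 + s.dir.2) := by
      intro r hr e hlt hsign
      have hpw := pairwise_finalPassages n
      have hnd : (finalPassages n).Nodup := hpw.imp fun h e ↦ h (congrArg _ e)
      rw [List.sum_map_eq_nsmul_single r, List.count_eq_one_of_mem hnd hr, one_smul,
        if_pos ⟨e, hlt⟩, hsign]
      intro r' hne hr'
      rw [if_neg]
      rintro ⟨e', -⟩
      have : Std.Symm fun p q : Passage ↦ p.point ≠ q.point := ⟨fun _ _ h ↦ h.symm⟩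
      exact hpw.forall hr' hr hne (e'.symm.trans e)
    rcases of_max_eq hn hq hs hmax with rfl | h
    · refine key ⟨(3 * n, 3 * n + 1), (1, 0), -1⟩ ?_ rfl (by simp [downUnder])
        (by simp [crossingSign, downUnder])
      rw [mem_finalPassages, OnWindOut]
      left
      simp
    · refine key ⟨s.point, (0, -1), -1⟩ ?_ rfl (by simp only; omega) ?_
      · rw [mem_finalPassages, OnChord]
        refine Or.inr ⟨rfl, Or.inr ⟨?_, rfl, Or.inr ⟨?_, ?_, rfl⟩⟩⟩ <;> simp only <;> omega
      · rcases h.2.2.2.2.1 with h1 | h1 <;> simp [crossingSign, h1, h.2.2.2.1]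
  · rw [neg_zero]
    apply List.sum_eq_zero
    intro z hz
    obtain ⟨r, hr, rfl⟩ := List.mem_map.1 hz
    rw [if_neg]
    rintro ⟨e, -⟩
    exact hmax (max_eq_of_mem_of_mem hq hs hr e)

/-- A loop in the first part of the diagram crosses the last part equally often in either
direction. -/
theorem underSum_finalPassages (hn : (n :: qs).Nodup) (hq : ∀ j ∈ n :: qs, 1 ≤ j ∧ j ≤ N)
    {u v x : List Passage} {p q : Passage}
    (hA : initialPassages N n qs = u ++ p :: (v ++ q :: x)) (e : p.point = q.point) :
    underSum v (finalPassages n) = 0 := by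
  have hchain : (p :: (v ++ [q])).IsChain
      fun r s ↦ fromOutside n s = fromOutside n r + outward n r := by
    have h := (isChain_initialPassages (N := N) (List.nodup_cons.1 hn).1).imp_of_mem_imp
      fun r s hr hs ↦ fromOutside_of_follows hn hq hr hs
    refine h.infix ⟨u, x, ?_⟩
    rw [hA]
    simp
  have hp : p ∈ initialPassages N n qs := by simp [hA]
  have hqm : q ∈ initialPassages N n qs := by simp [hA]
  have htr : Transversal p q := by
    have h := (List.pairwise_append.1 (pairwise_transversal hn hq)).1
    rw [hA, List.pairwise_append, List.pairwise_cons] at h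
    exact h.2.1.1 q (by simp)
  -- On the boundary, the first part has one passage on the top side and only horizontal ones on the
  -- right side, so no two of them cross there.
  have hmax : max p.point.1 p.point.2 ≠ 3 * n + 1 := by
    intro hmax
    have hmax' := hmax
    rw [e] at hmax'
    have h1 := htr e
    rw [Prod.ext_iff] at e
    rcases of_max_eq hn hq hp hmax with rfl | hp' <;>
      rcases of_max_eq hn hq hqm hmax' with rfl | hq'
    · exact h1.1 rfl
    · simp only [downUnder] at e
      omega
    · simp only [downUnder] at e
      omega
    · omega
  have h1 := sum_eq_sub_of_isChain hchain
  have h2 : outward n p = 0 := if_neg hmax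
  have h3 : fromOutside n q = fromOutside n p := by
    simp only [fromOutside, ← e, hmax, false_and]
  rw [h2, h3, sub_self, zero_add] at h1
  rw [underSum_eq_sum, List.map_congr_left (g := fun s ↦ -1 * outward n s),
    List.sum_map_mul_left, h1, mul_zero]
  intro s hs
  rw [sum_finalPassages hn hq (by simp [hA, hs]), neg_one_mul]

end Telescoping

end CausalKnot

namespace CausalKnot

/-! ### Linked pairs of the causal knot. -/

section Evaluation

/-- The number of entries greater than `k` after the first `k` in the list `L`. -/
def countAfter (k : ℕ) (L : List ℕ) : ℕ :=
  ((L.dropWhile (· ≠ k)).tail).countP (k < ·)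

theorem countAfter_cons (k i : ℕ) (L : List ℕ) :
    countAfter k (i :: L) = if i = k then L.countP (k < ·) else countAfter k L := by
  by_cases h : i = k <;> simp [countAfter, h]

theorem countAfter_of_notMem {k : ℕ} {L : List ℕ} (h : k ∉ L) : countAfter k L = 0 := by
  induction L with
  | nil => rfl
  | cons i L ih =>
    rw [List.mem_cons, not_or] at h
    rw [countAfter_cons, if_neg (Ne.symm h.1), ih h.2]

theorem countAfter_append_singleton {k n : ℕ} {L : List ℕ} (h : k ∉ L) :
    countAfter k (L ++ [n]) = 0 := by
  induction L with
  | nil => simp [countAfter_cons]; simp [countAfter]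
  | cons i L ih =>
    rw [List.mem_cons, not_or] at h
    rw [List.cons_append, countAfter_cons, if_neg (Ne.symm h.1), ih h.2]

/-- The indicator function of the passages `upUnder j` with `i < j`. -/
def upIndicator (i : ℕ) (r : Passage) : ℤ :=
  if r.height = -1 ∧ 3 ∣ r.point.2 ∧ 3 * i < r.point.2 then 1 else 0

theorem windIn_passages (i : ℕ) :
    (windIn i).passages = [⟨(3 * i - 1, 3 * i - 1), (0, 1), -1⟩, upUnder i] := by
  rw [windIn, Edge.passages_eq]
  have h1 : (3 * i + 1 - (3 * i - 1) : ℤ) = 2 := by ring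
  have h2 : Int.sign 2 = 1 := rfl
  simp [h1, h2, List.range_succ, upUnder]

theorem windOut_passages (i : ℕ) :
    (windOut i 1).passages = [⟨(3 * i - 1, 3 * i + 1), (1, 0), 1⟩, downOver i] := by
  rw [windOut, Edge.passages_eq]
  have h1 : (3 * i + 1 - (3 * i - 1) : ℤ) = 2 := by ring
  have h2 : Int.sign 2 = 1 := rfl
  simp [h1, h2, List.range_succ, downOver]

theorem sum_upIndicator_of_height {i : ℕ} {L : List Passage} (h : ∀ p ∈ L, p.height ≠ -1) :
    (L.map (upIndicator i)).sum = 0 := by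
  apply List.sum_eq_zero
  intro z hz
  obtain ⟨r, hr, rfl⟩ := List.mem_map.1 hz
  exact if_neg fun h' ↦ h r hr h'.1

theorem sum_upIndicator_windIn (i j : ℕ) :
    ((windIn j).passages.map (upIndicator i)).sum = if i < j then 1 else 0 := by
  rw [windIn_passages]
  simp only [List.map_cons, List.map_nil, List.sum_cons, List.sum_nil, upIndicator, upUnder,
    true_and]
  rw [if_neg (by omega)]
  by_cases h : i < j
  · rw [if_pos h, if_pos (by omega)]; rfl
  · rw [if_neg h, if_neg (by omega)]; rfl

theorem sum_upIndicator_chord {i : ℕ} {s t h : ℤ} (hh : 1 ≤ h) :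
    (((chord s t h).flatMap Edge.passages).map (upIndicator i)).sum = 0 := by
  refine sum_upIndicator_of_height fun p hp ↦ ?_
  rw [mem_passages_chord] at hp
  have := hp.1
  omega

theorem sum_upIndicator_dashedInit (i : ℕ) {h : ℤ} (s : ℤ) (n : ℕ) (qs : List ℕ) (hh : 1 ≤ h) :
    (((dashedInit h s n qs).flatMap Edge.passages).map (upIndicator i)).sum =
      (qs ++ [n]).countP (i < ·) := by
  induction qs generalizing h s with
  | nil =>
    rw [dashedInit, List.flatMap_append, List.flatMap_singleton, List.map_append, List.sum_append,
      sum_upIndicator_chord hh, sum_upIndicator_windIn]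
    simp [List.countP_cons]
  | cons j qs ih =>
    rw [dashedInit, List.flatMap_append, List.flatMap_append, List.flatMap_cons,
      List.flatMap_singleton, List.map_append, List.map_append, List.map_append, List.sum_append,
      List.sum_append, List.sum_append, sum_upIndicator_chord hh, sum_upIndicator_windIn,
      ih _ (by omega), windOut_passages, sum_upIndicator_of_height (by simp [downOver])]
    rw [List.cons_append, List.countP_cons]
    simp
    ring

/-- Once the path has come back over the line at `i`, it passes under the line exactly once at each
later vertex, the last vertex `n` included; the chords have positive height and are not counted. -/
theorem exists_split_dashedInit {i : ℕ} {h : ℤ} (s : ℤ) (n : ℕ) {qs : List ℕ} (hh : 1 ≤ h)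
    (hi : i ∈ qs) :
    ∃ u x, (dashedInit h s n qs).flatMap Edge.passages = u ++ downOver i :: x ∧
      (x.map (upIndicator i)).sum = countAfter i (qs ++ [n]) := by
  induction qs generalizing h s with
  | nil => simp at hi
  | cons j qs ih =>
    rw [dashedInit, List.flatMap_append, List.flatMap_append, List.flatMap_cons,
      List.flatMap_singleton, windOut_passages, List.cons_append, countAfter_cons]
    by_cases hij : j = i
    · subst hij
      refine ⟨(chord s (3 * j - 1) h).flatMap Edge.passages ++ ((windIn j).passages ++
        [⟨(3 * j - 1, 3 * j + 1), (1, 0), 1⟩]), _, ?_,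
        (sum_upIndicator_dashedInit j (3 * j + 1) n qs (by omega : 1 ≤ h + 1)).trans ?_⟩
      · simp
      · rw [if_pos rfl]
    · obtain ⟨u, x, hux, hx⟩ := ih (3 * j + 1) (by omega : 1 ≤ h + 1)
        ((List.mem_cons.1 hi).resolve_left (Ne.symm hij))
      rw [if_neg hij, hux]
      exact ⟨_, x, (List.append_assoc _ _ _).symm, hx⟩

theorem exists_eq_append_left {α : Type*} {a b u x : List α} {q : α} (h : a ++ b = u ++ q :: x)
    (hq : q ∉ a) : ∃ c, b = c ++ q :: x := by
  obtain ⟨c, -, hc⟩ | ⟨c, hc, hc'⟩ := List.append_eq_append_iff.1 h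
  · exact ⟨c, hc⟩
  · cases c with
    | nil => exact ⟨[], by simpa using hc'.symm⟩
    | cons y c =>
      rw [List.cons_append, List.cons.injEq] at hc'
      exact absurd (by simp [hc, hc'.1]) hq

theorem exists_eq_append_right {α : Type*} {a b u x : List α} {q : α} (h : a ++ b = u ++ q :: x)
    (hq : q ∉ b) : ∃ c, a = u ++ q :: c ∧ x = c ++ b := by
  obtain ⟨c, -, hc⟩ | ⟨c, hc, hc'⟩ := List.append_eq_append_iff.1 h
  · exact absurd (by simp [hc]) hq
  · cases c with
    | nil => exact absurd (by simp at hc'; simp [← hc']) hq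
    | cons y c =>
      rw [List.cons_append, List.cons.injEq] at hc'
      exact ⟨c, by rw [hc, hc'.1], hc'.2⟩

theorem eq_of_append_cons_eq {α : Type*} {u x v y : List α} {q : α}
    (h : u ++ q :: x = v ++ q :: y) (hn : (u ++ q :: x).Nodup) : x = y := by
  have hqu : q ∉ u := fun hq ↦ List.disjoint_of_nodup_append hn hq (by simp)
  have hqx : q ∉ x := (List.nodup_cons.1 hn.of_append_right).1
  obtain ⟨c, hc⟩ := exists_eq_append_left h hqu
  cases c with
  | nil => simpa using hc
  | cons z c =>
    rw [List.cons_append, List.cons.injEq] at hc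
    exact absurd (by simp [hc.2]) hqx

/-- The number of pairs of linked crossings the first of which is passed at `p`. -/
def pairValue (L : List ℕ) (p : Passage) : ℤ :=
  if p.height = 0 ∧ p.point.2 = p.point.1 + 1 ∧ 3 ∣ p.point.1 then
    countAfter (p.point.1 / 3).toNat L else 0

theorem pairValue_downUnder (L : List ℕ) (k : ℕ) :
    pairValue L (downUnder k) = countAfter k L := by
  have h : (3 * (k : ℤ)) / 3 = k := by omega
  simp [pairValue, downUnder, h]

variable {N n : ℕ} {qs : List ℕ}

theorem height_of_mem_finalPassages {p : Passage} (hp : p ∈ finalPassages n) :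
    p.height = -1 := by
  rw [mem_finalPassages] at hp
  rcases hp with hp | hp <;> exact hp.1

theorem neg_one_le_height {p : Passage} (hp : p ∈ initialPassages N n qs) : -1 ≤ p.height := by
  rw [initialPassages, List.mem_append, mem_passages_solidPart] at hp
  rcases hp with hp | hp
  · have := hp.1
    omega
  · have := height_of_mem_dashedInit le_rfl hp
    omega

theorem onSolid_of_height_eq_zero {p : Passage} (hp : p ∈ initialPassages N n qs)
    (h0 : p.height = 0) : OnSolid N p := by
  rw [initialPassages, List.mem_append, mem_passages_solidPart] at hp
  refine hp.resolve_right fun hp ↦ ?_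
  have := height_of_mem_dashedInit le_rfl hp
  omega

theorem underSum_eq_zero {v x : List Passage}
    (h : ∀ r ∈ x, ∀ s ∈ v, s.point = r.point → s.height ≤ r.height) : underSum v x = 0 := by
  apply List.sum_eq_zero
  intro z hz
  obtain ⟨r, hr, rfl⟩ := List.mem_map.1 hz
  apply List.sum_eq_zero
  intro z hz
  obtain ⟨s, hs, rfl⟩ := List.mem_map.1 hz
  exact if_neg fun h' ↦ (h r hr s hs h'.1).not_gt h'.2

theorem upOver_mem {k : ℕ} (hk : 1 ≤ k ∧ k ≤ N) : upOver k ∈ initialPassages N n qs := by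
  rw [initialPassages, List.mem_append, mem_passages_solidPart]
  refine Or.inl ⟨rfl, (k : ℤ) - 1, by omega, by omega, Or.inr ?_⟩
  simp only [upOver, and_true]
  omega

theorem eq_upUnder_of_upIndicator {j : ℕ} {r : Passage}
    (hr : r ∈ (dashedInit 1 (3 * N + 3) n qs).flatMap Edge.passages) (h : upIndicator j r ≠ 0) :
    ∃ k ∈ n :: qs, j < k ∧ r = upUnder k := by
  simp only [upIndicator, ne_eq, ite_eq_right_iff, one_ne_zero, imp_false, not_not] at h
  rcases of_mem_dashedInit hr with ⟨s', h', k, -, hc, hh, -⟩ | ⟨k, hk, hc⟩ | ⟨k, hk, hc⟩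
  · unfold OnChord at hc
    omega
  · unfold OnWindIn at hc
    refine ⟨k, hk, by omega, ?_⟩
    simp only [Passage.eq_iff, upUnder]
    omega
  · unfold OnWindOut at hc
    omega

/-- Within the first part, `r` can be under an earlier passage only as `upUnder k` below `upOver k`,
a crossing of sign +1. The passage `upOver k` lies in `v` precisely when it follows `downUnder j` on
the solid line, that is, when j < k. -/
theorem sum_crossingSign_eq_upIndicator (hn : (n :: qs).Nodup)
    (hq : ∀ j ∈ n :: qs, 1 ≤ j ∧ j ≤ N) {u v x : List Passage} {j : ℕ}
    (hA : initialPassages N n qs = u ++ downUnder j :: (v ++ downOver j :: x)) {r : Passage}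
    (hr : r ∈ x) (hrd : r ∈ (dashedInit 1 (3 * N + 3) n qs).flatMap Edge.passages) :
    (v.map fun s ↦ if s.point = r.point ∧ r.height < s.height then
      crossingSign s.dir r.dir else 0).sum = upIndicator j r := by
  have hpw := pairwise_initialPassages hn hq
  have hpw0 := pairwise_initialPassages_of_height_eq_zero N n qs
  have hnd := (nodup_of_pairwise_transversal (pairwise_transversal hn hq)).of_append_left
  rw [hA] at hpw hpw0 hnd
  rw [List.pairwise_append, List.pairwise_cons, List.pairwise_append, List.pairwise_cons] at hpw0
  have hvr : ∀ s ∈ v, s.point = r.point → r.height < s.height →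
      ∃ k ∈ n :: qs, s = upOver k ∧ r = upUnder k := by
    intro s hs e hlt
    rw [List.pairwise_append, List.pairwise_cons, List.pairwise_append] at hpw
    exact (hpw.2.1.2.2.2 s hs r (List.mem_cons_of_mem _ hr) e).resolve_left hlt.not_gt
  by_cases h : ∃ s ∈ v, s.point = r.point ∧ r.height < s.height
  · obtain ⟨s, hs, e, hlt⟩ := h
    obtain ⟨k, hk, rfl, rfl⟩ := hvr s hs e hlt
    -- Along the solid line the sum of the coordinates increases.
    have hjk := (hpw0.2.1.1 (upOver k) (by simp [hs]) rfl).2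
    have hvn : v.Nodup := (List.nodup_cons.1 hnd.of_append_right).2.of_append_left
    rw [List.sum_map_eq_nsmul_single (upOver k), List.count_eq_one_of_mem hvn hs, one_smul,
      if_pos ⟨e, hlt⟩]
    · simp only [upOver, downUnder] at hjk
      rw [upIndicator, if_pos]
      · rfl
      · simp only [upUnder, true_and]
        omega
    · intro s' hne hs'
      rw [if_neg]
      rintro ⟨e', hlt'⟩
      obtain ⟨k', -, rfl, hk'⟩ := hvr s' hs' e' hlt'
      simp [upUnder] at hk'
      exact hne (by rw [hk'])
  · rw [List.sum_eq_zero]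
    · by_contra hne
      obtain ⟨k, hk, hjk, rfl⟩ := eq_upUnder_of_upIndicator hrd (Ne.symm hne)
      apply h
      refine ⟨upOver k, ?_, rfl, by simp [upOver, upUnder]⟩
      have hmem := upOver_mem (n := n) (qs := qs) (hq k hk)
      rw [hA, List.mem_append, List.mem_cons, List.mem_append, List.mem_cons] at hmem
      rcases hmem with hmem | hmem | hmem | hmem | hmem
      · have := (hpw0.2.2 _ hmem (downUnder j) (by simp) rfl).2
        simp only [upOver, downUnder] at this
        omega
      · simp [upOver, downUnder] at hmem
      · exact hmem
      · simp [upOver, downOver] at hmem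
      · have := (hpw0.2.1.2.2.1.1 _ hmem rfl).1
        simp [downOver] at this
    · intro z hz
      obtain ⟨s, hs, rfl⟩ := List.mem_map.1 hz
      exact if_neg fun h' ↦ h ⟨s, hs, h'⟩

/-- If `p` is on the solid line, the crossing is a downward one, of sign +1, and the vertices
counted are those visited later and at a larger position. If `p` is on the dashed path, so is the
whole loop `v`, which then contains no `upOver k` and has nothing of the first part under it later
on. -/
theorem crossingSign_mul_underSum (hn : (n :: qs).Nodup) (hq : ∀ j ∈ n :: qs, 1 ≤ j ∧ j ≤ N)
    {u v x : List Passage} {p q : Passage}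
    (hA : initialPassages N n qs = u ++ p :: (v ++ q :: x)) (e : p.point = q.point)
    (hpq : p.height < q.height) :
    crossingSign q.dir p.dir * underSum v x = pairValue (qs ++ [n]) p := by
  have hpw0 := pairwise_initialPassages_of_height_eq_zero N n qs
  have hp : p ∈ initialPassages N n qs := by simp [hA]
  have hqm : q ∈ initialPassages N n qs := by simp [hA]
  by_cases h0 : p.height = 0
  · have hps := onSolid_of_height_eq_zero hp h0
    have hqd : q ∉ (solidPart N).flatMap Edge.passages := by
      rw [mem_passages_solidPart]
      intro h
      have := h.1
      omega
    have hqd' : q ∈ (dashedInit 1 (3 * N + 3) n qs).flatMap Edge.passages := by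
      rw [initialPassages, List.mem_append] at hqm
      exact hqm.resolve_left hqd
    rcases eq_of_solid_of_dashedInit hq hps hqd' e with ⟨j, -, rfl, rfl⟩ | ⟨j, hj, rfl, rfl⟩
    · simp [upOver, upUnder] at hpq
    have hsplit : (solidPart N).flatMap Edge.passages ++
        (dashedInit 1 (3 * N + 3) n qs).flatMap Edge.passages =
          (u ++ downUnder j :: v) ++ downOver j :: x := by
      rw [← initialPassages, hA]
      simp
    obtain ⟨c, hc⟩ := exists_eq_append_left hsplit hqd
    obtain ⟨c', y, hy, hsum⟩ := exists_split_dashedInit (3 * N + 3) n (le_refl (1 : ℤ)) hj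
    have hnd := (nodup_of_pairwise_transversal (pairwise_transversal hn hq)).of_append_left
    rw [initialPassages] at hnd
    have hxy := eq_of_append_cons_eq (hc.symm.trans hy) (hc ▸ hnd.of_append_right)
    have hsign : crossingSign (downOver j).dir (downUnder j).dir = 1 := by
      simp [crossingSign, downOver, downUnder]
    rw [hsign, one_mul, pairValue_downUnder, ← hsum, ← hxy, underSum]
    congr 1
    refine List.map_congr_left fun r hr ↦ ?_
    exact sum_crossingSign_eq_upIndicator hn hq hA hr (by rw [hc]; simp [hr])
  · rw [pairValue, if_neg fun h ↦ h0 h.1, underSum_eq_zero, mul_zero]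
    intro r hr s hs esr
    by_contra hlt
    have hpw := pairwise_initialPassages hn hq
    rw [hA, List.pairwise_append, List.pairwise_cons, List.pairwise_append] at hpw hpw0
    obtain ⟨k, -, rfl, -⟩ :=
      (hpw.2.1.2.2.2 s hs r (List.mem_cons_of_mem _ hr) esr).resolve_left (by omega)
    exact h0 (hpw0.2.1.1 (upOver k) (by simp [hs]) rfl).1

theorem sum_pairValue_of_height {L : List ℕ} {ps : List Passage} (h : ∀ p ∈ ps, p.height ≠ 0) :
    (ps.map (pairValue L)).sum = 0 := by
  apply List.sum_eq_zero
  intro z hz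
  obtain ⟨r, hr, rfl⟩ := List.mem_map.1 hz
  exact if_neg fun h' ↦ h r hr h'.1

theorem sum_pairValue_solidPart (L : List ℕ) (N : ℕ) :
    (((solidPart N).flatMap Edge.passages).map (pairValue L)).sum =
      ∑ k ∈ Finset.range (N + 1), (countAfter k L : ℤ) := by
  rw [solidPart, List.flatMap_assoc, List.map_flatMap, List.flatMap_def, List.sum_flatten,
    List.map_map, ← List.sum_toFinset _ List.nodup_range, List.toFinset_range]
  refine Finset.sum_congr rfl fun k _ ↦ ?_
  have h1 : (3 * k + 3 - 3 * k : ℤ) = 3 := by ring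
  have h2 : Int.sign 3 = 1 := rfl
  rw [← pairValue_downUnder]
  simp only [Function.comp_apply, List.flatMap_cons, List.flatMap_nil, List.append_nil,
    Edge.passages_eq, h1, sub_self, Int.natAbs_zero, List.map_append, List.map_map, List.sum_append]
  simp [h2, List.range_succ, pairValue, downUnder]

/-- The signed number of pairs of linked crossings of the diagram. -/
theorem linkedPairs_initialPassages_append (hn : (n :: qs).Nodup)
    (hq : ∀ j ∈ n :: qs, 1 ≤ j ∧ j ≤ N) :
    linkedPairs ((initialPassages N n qs ++ finalPassages n).flatMap
      (letters (initialPassages N n qs ++ finalPassages n))) =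
        ∑ k ∈ Finset.range (N + 1), (countAfter k (qs ++ [n]) : ℤ) := by
  have hpw := pairwise_transversal hn hq
  have hheight : ∀ p ∈ initialPassages N n qs ++ finalPassages n, -1 ≤ p.height := by
    intro p hp
    rcases List.mem_append.1 hp with hp | hp
    · exact neg_one_le_height hp
    · exact (height_of_mem_finalPassages hp).ge
  rw [linkedPairs_flatMap_letters hpw (pairValue (qs ++ [n]))]
  · rw [List.map_append, List.sum_append, initialPassages, List.map_append, List.sum_append,
      sum_pairValue_solidPart, sum_pairValue_of_height, sum_pairValue_of_height, add_zero, add_zero]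
    · intro p hp
      rw [height_of_mem_finalPassages hp]
      decide
    · intro p hp
      have := height_of_mem_dashedInit le_rfl hp
      omega
  · intro u p v q x hsplit e hlt
    have hp := hheight p (by simp [hsplit])
    -- The last strand has the lowest height, so it is never the over-strand.
    have hqf : q ∉ finalPassages n := by
      intro h
      have := height_of_mem_finalPassages h
      omega
    obtain ⟨c, hc, rfl⟩ := exists_eq_append_right (u := u ++ p :: v) (x := x)
      (by rw [hsplit]; simp) hqf
    have hA : initialPassages N n qs = u ++ p :: (v ++ q :: c) := by rw [hc]; simp
    rw [underSum_append, underSum_finalPassages hn hq hA e, add_zero]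
    exact crossingSign_mul_underSum hn hq hA e hlt
  · intro u p x hsplit hx
    by_contra hne
    obtain ⟨h0, h1, h2⟩ : p.height = 0 ∧ p.point.2 = p.point.1 + 1 ∧ 3 ∣ p.point.1 := by
      by_contra h
      exact hne (if_neg h)
    have hpA : p ∈ initialPassages N n qs := by
      have hp : p ∈ initialPassages N n qs ++ finalPassages n := by simp [hsplit]
      refine (List.mem_append.1 hp).resolve_right fun h ↦ ?_
      have := height_of_mem_finalPassages h
      omega
    obtain ⟨-, i, hi, hiN, hpi⟩ := onSolid_of_height_eq_zero hpA h0
    have hpk : p = downUnder i.toNat := by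
      simp only [Passage.eq_iff, downUnder]
      omega
    generalize i.toNat = k at hpk
    subst hpk
    rw [pairValue_downUnder, Nat.cast_eq_zero] at hne
    -- Only vertices at which the path winds have a downward over-crossing; the last one counts
    -- nothing, since no vertex follows it.
    have hk : k ∈ qs := by
      by_contra h
      exact hne (countAfter_append_singleton h)
    obtain ⟨c, y, hy, -⟩ := exists_split_dashedInit (3 * N + 3) n (le_refl (1 : ℤ)) hk
    have hmem : downOver k ∈ initialPassages N n qs := by
      rw [initialPassages, hy]
      simp
    obtain ⟨c, hc, rfl⟩ := exists_eq_append_right hsplit (fun h ↦ by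
      have := height_of_mem_finalPassages h
      simp [downUnder] at this)
    have hpw0 := pairwise_initialPassages_of_height_eq_zero N n qs
    rw [hc, List.pairwise_append] at hpw0
    rw [hc, List.mem_append, List.mem_cons] at hmem
    rcases hmem with hmem | hmem | hmem
    · have := (hpw0.2.2 _ hmem _ (by simp) h0).1
      simp [downOver] at this
    · simp [downOver, downUnder] at hmem
    · have := hx _ (List.mem_append_left _ hmem) rfl
      simp [downOver, downUnder] at this

end Evaluation

end CausalKnot

namespace CausalKnot

/-! ### Linked pairs and pairs of events with opposite order. -/

section Counting

/-- In a list sorted by an asymmetric relation, the entries after `a` are those to which `a` is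
related. -/
theorem countAfter_map {α : Type*} {f : α → ℕ} (hf : Function.Injective f) {R : α → α → Prop}
    [DecidableRel R] [Std.Asymm R] {M : List α} (hM : M.Pairwise R) {a : α} (ha : a ∈ M) :
    countAfter (f a) (M.map f) = M.countP fun b ↦ R a b ∧ f a < f b := by
  induction M with
  | nil => simp at ha
  | cons c M ih =>
    rw [List.pairwise_cons] at hM
    rw [List.map_cons, countAfter_cons, List.countP_cons]
    by_cases hca : c = a
    · subst hca
      rw [if_pos rfl, List.countP_map, if_neg (by simp), add_zero]
      refine List.countP_congr fun b hb ↦ ?_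
      simp [hM.1 b hb]
    · have ha' : a ∈ M := (List.mem_cons.1 ha).resolve_left (Ne.symm hca)
      have hac : ¬ R a c := Std.Asymm.asymm _ _ (hM.1 a ha')
      rw [if_neg (hf.ne hca), ih hM.2 ha', if_neg (by simp [hac]), add_zero]

variable {N : ℕ} {τ τA τB : Fin N → ℝ}

theorem strictMono_comp_orderedEvents (hτ : Function.Injective τ) :
    StrictMono (τ ∘ orderedEvents τ) :=
  (Tuple.monotone_sort τ).strictMono_of_injective (hτ.comp (orderedEvents τ).injective)

theorem position_lt_position (hτ : Function.Injective τ) (a b : Fin N) :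
    position τ a < position τ b ↔ τ a < τ b := by
  have h := (strictMono_comp_orderedEvents hτ).lt_iff_lt (a := (orderedEvents τ).symm a)
    (b := (orderedEvents τ).symm b)
  simp only [Function.comp_apply, Equiv.apply_symm_apply] at h
  rw [position, position, h, Fin.lt_def]
  omega

theorem position_injective (τ : Fin N → ℝ) : Function.Injective (position τ) := by
  intro a b h
  apply (orderedEvents τ).symm.injective
  rw [Fin.ext_iff]
  unfold position at h
  omega

theorem pairwise_orderedEvents (hτ : Function.Injective τ) :
    (List.ofFn (orderedEvents τ)).reverse.Pairwise fun a b ↦ τ b < τ a := by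
  rw [List.pairwise_reverse, List.pairwise_ofFn]
  exact fun i j hij ↦ strictMono_comp_orderedEvents hτ hij

theorem mem_reverse_orderedEvents (τ : Fin N → ℝ) (a : Fin N) :
    a ∈ (List.ofFn (orderedEvents τ)).reverse := by
  rw [List.mem_reverse, List.mem_ofFn]
  exact (orderedEvents τ).surjective a

theorem nodup_reverse_orderedEvents (τ : Fin N → ℝ) :
    (List.ofFn (orderedEvents τ)).reverse.Nodup := by
  rw [List.nodup_reverse, List.nodup_ofFn]
  exact (orderedEvents τ).injective

/-- The number of pairs of events with opposite order, counted along the dashed path. -/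
theorem sum_countAfter (hA : Function.Injective τA) (hB : Function.Injective τB) :
    ∑ k ∈ Finset.range (N + 1),
      countAfter k ((List.ofFn (orderedEvents τB)).reverse.map (position τA)) =
        ∑ a : Fin N, ∑ b : Fin N, if τA a < τA b ∧ τB b < τB a then 1 else 0 := by
  classical
  have hsub : Finset.univ.image (position τA) ⊆ Finset.range (N + 1) := by
    intro k hk
    obtain ⟨a, -, rfl⟩ := Finset.mem_image.1 hk
    rw [Finset.mem_range, position]
    omega
  -- The range also contains 0, from the first step of the staircase; it is no position and counts
  -- nothing.
  rw [← Finset.sum_subset hsub, Finset.sum_image fun a _ b _ h ↦ position_injective τA h]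
  · refine Finset.sum_congr rfl fun a _ ↦ ?_
    have : Std.Asymm fun a b ↦ τB b < τB a := ⟨fun _ _ h ↦ h.not_gt⟩
    rw [countAfter_map (position_injective τA) (pairwise_orderedEvents hB)
      (mem_reverse_orderedEvents τB a), List.countP_eq_length_filter,
      ← List.toFinset_card_of_nodup ((nodup_reverse_orderedEvents τB).filter _),
      List.toFinset_filter, ← Finset.card_filter]
    congr 1
    ext b
    simp [position_lt_position hA, and_comm]
    exact fun _ _ ↦ (orderedEvents τB).surjective b
  · intro k _ hk
    apply countAfter_of_notMem
    intro h
    obtain ⟨a, -, rfl⟩ := List.mem_map.1 h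
    exact hk (Finset.mem_image_of_mem _ (Finset.mem_univ a))

theorem ite_abs_causalOrder_sub (hA : Function.Injective τA) (hB : Function.Injective τB)
    {i j : Fin N} (hij : i ≠ j) :
    (if |causalOrder τA i j - causalOrder τB i j| = 0 then 0 else 1) =
      (if τA i < τA j ∧ τB j < τB i then 1 else 0) +
        if τA j < τA i ∧ τB i < τB j then 1 else 0 := by
  have h1 := hA.ne hij
  have h2 := hB.ne hij
  unfold causalOrder
  rcases h1.lt_or_gt with h1 | h1 <;> rcases h2.lt_or_gt with h2 | h2 <;>
    simp [h1, h2, h1.not_gt, h2.not_gt, sign_pos, sign_neg]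

/-- An unordered pair with opposite order appears in exactly one orientation in which the first
event is earlier in A and later in B. The double sum is split according to the order of the labels
and folded back onto i < j. -/
theorem causalIndefiniteness_eq_sum (hA : Function.Injective τA) (hB : Function.Injective τB) :
    causalIndefiniteness τA τB =
      ∑ a : Fin N, ∑ b : Fin N, if τA a < τA b ∧ τB b < τB a then 1 else 0 := by
  have hsplit : ∀ a b : Fin N, (if τA a < τA b ∧ τB b < τB a then 1 else 0) =
      (if a < b then if τA a < τA b ∧ τB b < τB a then 1 else 0 else 0) +
        if b < a then if τA a < τA b ∧ τB b < τB a then 1 else 0 else 0 := by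
    intro a b
    rcases lt_trichotomy a b with h | rfl | h
    · simp [h, h.not_gt]
    · simp
    · simp [h, h.not_gt]
  rw [Finset.sum_congr rfl fun a _ ↦ Finset.sum_congr rfl fun b _ ↦ hsplit a b]
  simp only [Finset.sum_add_distrib]
  rw [Finset.sum_comm (f := fun a b : Fin N ↦
    if b < a then if τA a < τA b ∧ τB b < τB a then 1 else 0 else 0), ← Finset.sum_add_distrib]
  refine Finset.sum_congr rfl fun i _ ↦ ?_
  rw [Finset.sum_filter, ← Finset.sum_add_distrib]
  refine Finset.sum_congr rfl fun j _ ↦ ?_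
  by_cases hij : i < j
  · simp only [if_pos hij]
    exact ite_abs_causalOrder_sub hA hB hij.ne
  · simp only [if_neg hij, add_zero]

theorem coeff_two_conway_causalKnot (hA : Function.Injective τA) (hB : Function.Injective τB) :
    (conway (causalKnot τA τB).gaussCode).coeff 2 = (causalIndefiniteness τA τB : ℤ) := by
  rw [causalIndefiniteness_eq_sum hA hB, ← sum_countAfter hA hB, causalKnot]
  have hlen : ((List.ofFn (orderedEvents τB)).reverse.map (position τA)).length = N := by simp
  have hnd := (nodup_reverse_orderedEvents τB).map (position_injective τA)
  have hmem : ∀ j ∈ (List.ofFn (orderedEvents τB)).reverse.map (position τA), 1 ≤ j ∧ j ≤ N := by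
    intro j hj
    obtain ⟨a, -, rfl⟩ := List.mem_map.1 hj
    unfold position
    omega
  rcases List.eq_nil_or_concat ((List.ofFn (orderedEvents τB)).reverse.map (position τA)) with
    h | ⟨qs, n, h⟩
  -- Without events there is no last vertex to split off, and the diagram has no crossings.
  · rw [h]
    have hg : (knotOfPositions []).gaussCode = [[]] := by rfl
    rw [hg, coeff_two_conway (by simp [meets])]
    simp [linkedPairs, countAfter]
  · rw [List.concat_eq_append] at h
    rw [h] at hlen hnd hmem ⊢
    have hperm := List.perm_append_singleton n qs
    have hn : (n :: qs).Nodup := hperm.nodup_iff.1 hnd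
    have hq : ∀ j ∈ n :: qs, 1 ≤ j ∧ j ≤ N := fun j hj ↦ hmem j (hperm.mem_iff.2 hj)
    have hps := passages_knotOfPositions n qs
    rw [hlen] at hps
    rw [coeff_two_conway_gaussCode _ (hps ▸ pairwise_transversal hn hq), hps,
      linkedPairs_initialPassages_append hn hq, Nat.cast_sum]

end Counting

end CausalKnot

theorem mainTheorem1 {dA dB : ℕ} {MA MB : Type*}
    [TopologicalSpace MA] [ChartedSpace (EuclideanSpace ℝ (Fin dA)) MA] [IsManifold (𝓡 dA) ∞ MA]
    [TopologicalSpace MB] [ChartedSpace (EuclideanSpace ℝ (Fin dB)) MB] [IsManifold (𝓡 dB) ∞ MB]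
    (SA : CausalKnot.Spacetime dA MA) (SB : CausalKnot.Spacetime dB MB) (N : ℕ)
    (EA : CausalKnot.Events SA N) (EB : CausalKnot.Events SB N)
    (hAB : CausalKnot.IsConcatenation EA.properTime EB.properTime fun T ↦
      CausalKnot.IsDefinite EA.properTime EB.properTime T ∨
        CausalKnot.IsMaximallyIndefinite EA.properTime EB.properTime T) :
    (CausalKnot.conway
      (CausalKnot.causalKnot EA.properTime EB.properTime).gaussCode).coeff 2 =
        (CausalKnot.causalIndefiniteness EA.properTime EB.properTime : ℤ) := by

  -- Distinct crossing points on the particle's worldline have distinct proper times.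
  exact CausalKnot.coeff_two_conway_causalKnot
    (Function.Injective.of_comp (f := EA.particle.curve) EA.distinct)
    (Function.Injective.of_comp (f := EB.particle.curve) EB.distinct)
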